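/- **Setting.** Let $\mathcal G=(\mathcal V,\mathcal E)$ be a finite directed graph with destination $d\in\mathcal V$, link capacities $C_{ij}\ge 0$ and unit costs $e_{ij}\in\mathbb R$, and let $\mathcal L=\{1,\dots,L\}$ be the set of lifetimes. In each slot $t=0,1,2,\dots$ a number $a_i^{(l)}(t)\in\{0,1,2,\dots\}$ of packets of lifetime $l\in\mathcal L$ arrives at node $i$. The vectors $a(t)$ are i.i.d. over time (with an arbitrary common law on vectors), bounded, with $a_d^{(l)}(t)=0$, and $\lambda_i^{(l)}=\mathbb E\,a_i^{(l)}(t)$. A policy chooses nonnegative real flows $x_{ij}^{(l)}(t)$, $(i,j)\in\mathcal E$, $l\in\mathcal L$, at each slot $t$, possibly at random and depending on the past, but independently of $a(t),a(t+1),\dots$ Write $x_{ij}=\sum_{l\in\mathcal L}x_{ij}^{(l)}$, $x_{i\to}^{(l)}=\sum_{j:(i,j)\in\mathcal E}x_{ij}^{(l)}$, $x_{\to i}^{(l)}=\sum_{j:(j,i)\in\mathcal E}x_{ji}^{(l)}$, $x_{\to d}=\sum_{l\in\mathcal L}x_{\to d}^{(l)}$, $z^{(\ge l)}=\sum_{\ell=l}^{L}z^{(\ell)}$,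 $\|\lambda\|_1=\sum_{i\in\mathcal V,\,l\in\mathcal L}\lambda_i^{(l)}$, and $\overline{z}=\lim_{T\to\infty}\frac1T\sum_{t=0}^{T-1}\mathbb E\,z(t)$; a constraint involving $\overline{z}$ includes the existence of this limit. Queues start at $Q(0)=0$ and evolve by $$Q_i^{(l)}(t+1)=Q_i^{(l+1)}(t)-x_{i\to}^{(l+1)}(t)+x_{\to i}^{(l+1)}(t)+a_i^{(l)}(t)\qquad(i\ne d,\ l\in\mathcal L),$$ with $Q_i^{(0)}=Q_i^{(L+1)}=Q_d^{(l)}=0$ and $x^{(L+1)}=0$. * A policy is feasible for $\mathscr P_1$ if $\overline{x_{\to d}}\ge\gamma\|\lambda\|_1$, $\overline{x_{ij}}\le C_{ij}$ for all $(i,j)\in\mathcal E$, and almost surely $x_{i\to}^{(l)}(t)\le Q_i^{(l)}(t)$ for all $i\in\mathcal V$, $l\in\mathcal L$, $t$. * A policy is feasible for $\mathscr P_2$ if $\overline{x_{\to d}}\ge\gamma\|\lambda\|_1$, almost surely $x_{ij}(t)\le C_{ij}$ for all $(i,j)\in\mathcal E$ and $x_{dk}^{(l)}(t)=0$ for all $(d,k)\in\mathcal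 E$, $l\in\mathcal L$ and all $t$, and $\overline{x_{i\to}^{(\ge l)}}\le\overline{x_{\to i}^{(\ge l+1)}}+\lambda_i^{(\ge l)}$ for all $i\in\mathcal V$, $l\in\mathcal L$. In both problems the cost of a policy is $\overline{\sum_{(i,j)\in\mathcal E}e_{ij}x_{ij}}$, and the stability region $\Lambda_\iota$ ($\iota=1,2$) is the set of pairs $(\lambda,\gamma)$, $\gamma\in\mathbb R$, for which $\mathscr P_\iota$ has a feasible policy under some arrival law with mean $\lambda$. **Theorem.** (i) $\Lambda_1=\Lambda_2$. Moreover, for each $\iota$ and every arrival law with mean $\lambda$, $\mathscr P_\iota$ has a feasible policy under that law if and only if $(\lambda,\gamma)\in\Lambda_\iota$. (ii) For $\lambda\ge 0$ with $\lambda_d=0$ and $\gamma\in\mathbb R$, the pair $(\lambda,\gamma)$ lies in $\Lambda_\iota$ ($\iota=1,2$) if and only if there are $x_{ij}^{(l)}\ge0$, $(i,j)\in\mathcal E$, $l\in\mathcal L$ (with the convention $x_{ij}^{(0)}=0$), such that $$x_{\to d}\ge\gamma\|\lambda\|_1,\qquad x_{ij}\le C_{ij},\qquad x_{\to i}^{(\ge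 l+1)}+\lambda_i^{(\ge l)}\ge x_{i\to}^{(\ge l)},\qquad x_{dk}^{(l)}=0$$ for all $i\in\mathcal V$, $(i,j),(d,k)\in\mathcal E$ and $l\in\mathcal L$. (iii) For $\iota=1,2$, every $(\lambda,\gamma)\in\Lambda_\iota$ and every arrival law with mean $\lambda$, some feasible stationary randomized policy for $\mathscr P_\iota$ attains the minimum of the cost over all feasible policies (for which the cost limit exists). Here a stationary randomized policy is, for $\mathscr P_1$, one in which at every slot each packet of lifetime $l$ queued at node $i$ is independently (of all other choices and of the arrivals) sent over a link $(i,j)$ or kept, with probabilities depending only on $(i,l,j)$; for $\mathscr P_2$, one in which at every slot and for every link $(i,j)$ a lifetime $l^*$ or idling is drawn independently (over slots and links, and of the arrivals) with time-invariant probabilities, and $x_{ij}^{(l)}(t)=C_{ij}$ if $l=l^*$ and $0$ otherwise. -/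

import Mathlib

open MeasureTheory ProbabilityTheory Filter Topology
open scoped NNReal BigOperators

noncomputable section

namespace DelayNet

/-- A packet routing network: a directed graph with a destination, a maximum lifetime `L`, and a
capacity and a unit cost for every link (values off the links are never used). -/
structure Network (V : Type) where
  graph : Digraph V
  dest : V
  L : ℕ
  cap : V → V → ℝ≥0
  cost : V → V → ℝ

/-- `x i j l` is the amount of lifetime-`l` packets sent over link `(i, j)`. -/
abbrev Flow (V : Type) := V → V → ℕ → ℝ

/-- `a i l` is the number of exogenous lifetime-`l` packets arriving at node `i`. -/
abbrev Arrivals (V : Type) := V → ℕ → ℕ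

/-- A family of mean arrival rates, indexed by node and lifetime. -/
abbrev Rates (V : Type) := V → ℕ → ℝ

section Flows

variable {V : Type} [Fintype V]

/-- Outgoing flow of lifetime `l` at node `i`. -/
def outflow (x : Flow V) (i : V) (l : ℕ) : ℝ := ∑ j, x i j l

/-- Incoming flow of lifetime `l` at node `i`. -/
def inflow (x : Flow V) (i : V) (l : ℕ) : ℝ := ∑ j, x j i l

/-- Outgoing flow of lifetime at least `l` (and at most `L`). -/
def outflowGe (N : Network V) (x : Flow V) (i : V) (l : ℕ) : ℝ :=
  ∑ m ∈ Finset.Icc l N.L, outflow x i m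

/-- Incoming flow of lifetime at least `l` (and at most `L`). -/
def inflowGe (N : Network V) (x : Flow V) (i : V) (l : ℕ) : ℝ :=
  ∑ m ∈ Finset.Icc l N.L, inflow x i m

/-- Total flow on the link `(i, j)`, over the lifetimes `1, …, L`. -/
def linkFlow (N : Network V) (x : Flow V) (i j : V) : ℝ :=
  ∑ l ∈ Finset.Icc 1 N.L, x i j l

/-- Total flow into the destination, over the lifetimes `1, …, L`. -/
def delivered (N : Network V) (x : Flow V) : ℝ := inflowGe N x N.dest 1

/-- The operational cost `∑ e_ij x_ij`. -/
def flowCost (N : Network V) (x : Flow V) : ℝ := ∑ i, ∑ j, N.cost i j * linkFlow N x i j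

/-- Nonnegative flow variables, indexed by the links and the lifetimes `1, …, L`
(extended by zero). -/
structure IsFlow (N : Network V) (x : Flow V) : Prop where
  nonneg : ∀ i j l, 0 ≤ x i j l
  support : ∀ i j l, ¬ (N.graph.Adj i j ∧ l ∈ Finset.Icc 1 N.L) → x i j l = 0

/-- Arrival rate of packets of lifetime at least `l` at node `i`. -/
def rateGe (N : Network V) (lam : Rates V) (i : V) (l : ℕ) : ℝ :=
  ∑ m ∈ Finset.Icc l N.L, lam i m

/-- `‖λ‖₁`. -/
def rateNorm (N : Network V) (lam : Rates V) : ℝ := ∑ i, ∑ l ∈ Finset.Icc 1 N.L, |lam i l|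

/-- Rate vectors: nonnegative, with sources among the nodes other than the destination and
lifetimes in `1, …, L`. -/
structure IsRate (N : Network V) (lam : Rates V) : Prop where
  nonneg : ∀ i l, 0 ≤ lam i l
  support : ∀ i l, (i = N.dest ∨ l ∉ Finset.Icc 1 N.L) → lam i l = 0

/-- The linear conditions on a lifetime-indexed flow. -/
structure FlowConditions (N : Network V) (lam : Rates V) (γ : ℝ) (x : Flow V) : Prop where
  isFlow : IsFlow N x
  reliability : γ * rateNorm N lam ≤ delivered N x
  capacity : ∀ i j, N.graph.Adj i j → linkFlow N x i j ≤ N.cap i j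
  conservation : ∀ i, ∀ l ∈ Finset.Icc 1 N.L,
    outflowGe N x i l ≤ inflowGe N x i (l + 1) + rateGe N lam i l
  lifetime_zero : ∀ i j, N.graph.Adj i j → x i j 0 = 0
  dest_silent : ∀ k, N.graph.Adj N.dest k → ∀ l ∈ Finset.Icc 1 N.L, x N.dest k l = 0

end Flows

section Arrivals

variable {V : Type}

/-- Laws of the arrivals of one slot: bounded packet counts, with no arrivals at the destination
or outside the lifetimes `1, …, L`. -/
structure IsArrivalLaw (N : Network V) (ρ : Measure (Arrivals V)) : Prop where
  prob : IsProbabilityMeasure ρ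
  bounded : ∃ A : ℕ, ∀ᵐ a ∂ρ, ∀ i l, a i l ≤ A
  support : ∀ᵐ a ∂ρ, ∀ i l, (i = N.dest ∨ l ∉ Finset.Icc 1 N.L) → a i l = 0

/-- The vector of mean arrival rates. -/
def meanRate (ρ : Measure (Arrivals V)) : Rates V := fun i l => ∫ a, (a i l : ℝ) ∂ρ

end Arrivals

section Queues

variable {V : Type} [Fintype V] [DecidableEq V]

/-- Lifetime queues along one sample path, started empty. Outdated packets are dropped and the
destination consumes its packets at once; there is no queue for lifetimes above `L`. -/
def queue (N : Network V) (a : ℕ → Arrivals V) (x : ℕ → Flow V) : ℕ → V → ℕ → ℝ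
  | 0 => fun _ _ => 0
  | t + 1 => fun i l =>
      if i = N.dest ∨ l ∉ Finset.Icc 1 N.L then 0
      else queue N a x t i (l + 1) - outflow (x t) i (l + 1) + inflow (x t) i (l + 1) + a t i l

end Queues

/-- A (possibly randomized, history-dependent) control policy run against an arrival process that
is i.i.d. over the slots with one-slot law `ρ`. The decision of slot `t` is taken on the
information `ℱ t`, which contains the arrivals of the slots before `t` and any randomization used
so far, and is independent of the arrivals of slot `t`. -/
structure Policy {V : Type} [Fintype V] (N : Network V) (ρ : Measure (Arrivals V)) where
  Ω : Type
  mΩ : MeasurableSpace Ω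
  P : Measure Ω
  prob : IsProbabilityMeasure P
  ℱ : Filtration ℕ mΩ
  /-- the arrival process -/
  a : ℕ → Ω → Arrivals V
  /-- the decisions -/
  x : ℕ → Ω → Flow V
  a_adapted : ∀ t, Measurable[ℱ (t + 1)] (a t)
  a_law : ∀ t, P.map (a t) = ρ
  a_indep : ∀ t, Indep (ℱ t) (MeasurableSpace.comap (a t) inferInstance) P
  x_adapted : ∀ t, Measurable[ℱ t] (x t)
  x_isFlow : ∀ᵐ ω ∂P, ∀ t, IsFlow N (x t ω)

attribute [instance] Policy.mΩ Policy.prob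

/-- A random choice among the elements of `α` and idling (`none`). -/
def Choice (α : Type) := Option α

instance (α : Type) : MeasurableSpace (Choice α) := ⊤

namespace Policy

variable {V : Type} [Fintype V] {N : Network V} {ρ : Measure (Arrivals V)}

/-- The long-term average `lim (1/T) ∑_{t<T} 𝔼[f (x t)]` exists and equals `m`. -/
def HasTimeAvg (p : Policy N ρ) (f : Flow V → ℝ) (m : ℝ) : Prop :=
  Tendsto (fun T : ℕ => (1 / (T : ℝ)) * ∑ t ∈ Finset.range T, ∫ ω, f (p.x t ω) ∂p.P)
    atTop (𝓝 m)

/-- The policy has long-term average expected cost `c`. -/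
def HasCost (p : Policy N ρ) (c : ℝ) : Prop := p.HasTimeAvg (flowCost N) c

/-- The timely throughput is at least the fraction `γ` of the total arrival rate. -/
def Reliable (p : Policy N ρ) (γ : ℝ) : Prop :=
  ∃ r, p.HasTimeAvg (delivered N) r ∧ γ * rateNorm N (meanRate ρ) ≤ r

/-- Feasibility for the virtual-network problem. -/
structure Feasible₂ (p : Policy N ρ) (γ : ℝ) : Prop where
  reliable : p.Reliable γ
  peak_capacity : ∀ᵐ ω ∂p.P, ∀ t i j, N.graph.Adj i j → linkFlow N (p.x t ω) i j ≤ N.cap i j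
  causality : ∀ i, ∀ l ∈ Finset.Icc 1 N.L, ∃ o ι,
    p.HasTimeAvg (fun x => outflowGe N x i l) o ∧
    p.HasTimeAvg (fun x => inflowGe N x i (l + 1)) ι ∧
    o ≤ ι + rateGe N (meanRate ρ) i l
  /-- the destination consumes every packet and forwards none -/
  dest_silent : ∀ᵐ ω ∂p.P, ∀ t k, N.graph.Adj N.dest k → ∀ l ∈ Finset.Icc 1 N.L,
    p.x t ω N.dest k l = 0

/-- Stationary randomized policy for the virtual network: in every slot and on every link `(i, j)`
one lifetime (or idling) is drawn, independently over slots and links and of the arrivals, from a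
time-invariant distribution `α i j`; the link then carries `C_ij` units of the drawn lifetime. -/
def StationaryRandomized₂ (p : Policy N ρ) : Prop :=
  ∃ (α : V → V → PMF (Choice ℕ)) (D : ℕ × V × V → p.Ω → Choice ℕ),
    (∀ k, Measurable (D k)) ∧
    iIndepFun D p.P ∧
    (∀ t i j, p.P.map (D (t, i, j)) = (α i j).toMeasure) ∧
    IndepFun (fun ω k => D k ω) (fun ω t => p.a t ω) p.P ∧
    ∀ t ω i j l, (D (t, i, j) ω = some l → p.x t ω i j l = N.cap i j) ∧
      (D (t, i, j) ω ≠ some l → p.x t ω i j l = 0)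

variable [DecidableEq V]

/-- The queue backlogs produced by the policy. -/
def backlog (p : Policy N ρ) (t : ℕ) (i : V) (l : ℕ) (ω : p.Ω) : ℝ :=
  queue N (fun s => p.a s ω) (fun s => p.x s ω) t i l

/-- Feasibility for the average-capacity-constrained problem. -/
structure Feasible₁ (p : Policy N ρ) (γ : ℝ) : Prop where
  reliable : p.Reliable γ
  avg_capacity : ∀ i j, N.graph.Adj i j →
    ∃ c, p.HasTimeAvg (fun x => linkFlow N x i j) c ∧ c ≤ N.cap i j
  availability : ∀ᵐ ω ∂p.P, ∀ t i, ∀ l ∈ Finset.Icc 1 N.L,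
    outflow (p.x t ω) i l ≤ p.backlog t i l ω

/-- Stationary randomized policy for the actual network: in every slot `t`, each packet (numbered
`n = 0, 1, …`) in the lifetime-`l` queue of node `i` draws the neighbor it is sent to, or idling,
independently of all other draws and of the arrivals, from a time-invariant distribution `α i l`.
The backlogs of such a policy are whole numbers, so that the floor does not change them. -/
def StationaryRandomized₁ (p : Policy N ρ) : Prop :=
  ∃ (α : V → ℕ → PMF (Choice V)) (D : ℕ × V × ℕ × ℕ → p.Ω → Choice V),
    (∀ k, Measurable (D k)) ∧
    iIndepFun D p.P ∧
    (∀ t i l n, p.P.map (D (t, i, l, n)) = (α i l).toMeasure) ∧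
    IndepFun (fun ω k => D k ω) (fun ω t => p.a t ω) p.P ∧
    ∀ t ω i j l, p.x t ω i j l =
      ({n : ℕ | n < ⌊p.backlog t i l ω⌋₊ ∧ D (t, i, l, n) ω = some j}.ncard : ℝ)

end Policy

section Regions

variable {V : Type} [Fintype V] [DecidableEq V] (N : Network V)

/-- The feasible policy space of the average-capacity-constrained problem. -/
def feasiblePolicies₁ (ρ : Measure (Arrivals V)) (γ : ℝ) : Set (Policy N ρ) :=
  {p | p.Feasible₁ γ}

/-- The costs attained by the feasible policies of the average-capacity-constrained problem. -/
def costs₁ (ρ : Measure (Arrivals V)) (γ : ℝ) : Set ℝ :=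
  {c | ∃ p ∈ feasiblePolicies₁ N ρ γ, p.HasCost c}

/-- The stability region of the average-capacity-constrained problem: the pairs of a mean arrival
rate vector (of some arrival law) and a reliability level with a feasible policy. -/
def stabilityRegion₁ : Set (Rates V × ℝ) :=
  {q | ∃ ρ, IsArrivalLaw N ρ ∧ meanRate ρ = q.1 ∧ (feasiblePolicies₁ N ρ q.2).Nonempty}

end Regions

section Regions

variable {V : Type} [Fintype V] (N : Network V)

/-- The feasible policy space of the virtual-network problem. -/
def feasiblePolicies₂ (ρ : Measure (Arrivals V)) (γ : ℝ) : Set (Policy N ρ) :=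
  {p | p.Feasible₂ γ}

/-- The costs attained by the feasible policies of the virtual-network problem. -/
def costs₂ (ρ : Measure (Arrivals V)) (γ : ℝ) : Set ℝ :=
  {c | ∃ p ∈ feasiblePolicies₂ N ρ γ, p.HasCost c}

/-- The stability region of the virtual-network problem. -/
def stabilityRegion₂ : Set (Rates V × ℝ) :=
  {q | ∃ ρ, IsArrivalLaw N ρ ∧ meanRate ρ = q.1 ∧ (feasiblePolicies₂ N ρ q.2).Nonempty}

end Regions

end DelayNet

end

/-! Both problems reduce to one linear program: its admissible points are the flows satisfying
`FlowConditions`, and it sees the arrival law only through the mean rates.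

Necessity. The decisions of a feasible policy are almost surely uniformly bounded. In the virtual
network this is the peak capacity; in the actual one packets live at most `L` slots, so the backlogs
stay bounded (`sum_queue_le`). By compactness the time averages of the expected decisions accumulate
at some flow `x` (`Policy.BoundedBy.exists_limit`). Throughput, link loads and cost are linear, so
any such time average that exists is the value of the functional at `x`
(`Policy.BoundedBy.apply_limit`). Causality passes to `x` directly in the virtual problem. In the
actual one, averaging the queue recursion downwards from lifetime `L + 1` shows that the average
backlogs tend to `stationaryBacklog` (`Policy.Available.tendsto_meanBacklog`), and "outflow at most
backlog" becomes the conservation inequality.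

Sufficiency. Given an admissible `x`, the virtual network draws lifetime `l` on link `(i, j)` with
probability `x i j l / cap i j`, so that the mean decision is `x` in every slot
(`FlowConditions.exists_policy₂`). In the actual network each packet is sent to `j` with probability
`x i j l / stationaryBacklog`. Since the slot's draws are independent of the current backlog, mean
flows are these fractions of mean backlogs (`integral_sum_range_marks`). Backlogs of lifetime `l`
depend only on those of lifetime `l + 1` one slot earlier, so the means become exactly stationary
after finitely many slots and the mean flow is then `x` (`Policy.Available.meanBacklog_eq`,
`FlowConditions.exists_policy₁`).

Optimality. The admissible flows form a compact set, so a cheapest one exists; the policy built from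
it has its cost, while every competing cost is the cost of some admissible flow. Finally, every rate
vector is the mean of some law (`exists_isArrivalLaw`), which identifies the regions. -/

noncomputable section

namespace DelayNet
-- Linear functionals of flows
section LinearFunctionals

variable {V : Type}

/-- The finite linear combinations of the coordinates of a flow. -/
def flowFunctionals (V : Type) : Submodule ℝ (Flow V → ℝ) :=
  Submodule.span ℝ (Set.range fun k : V × V × ℕ => fun x : Flow V => x k.1 k.2.1 k.2.2)

lemma coord_mem_flowFunctionals (i j : V) (l : ℕ) :
    (fun x : Flow V => x i j l) ∈ flowFunctionals V :=
  Submodule.subset_span ⟨(i, j, l), rfl⟩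

lemma sum_mem_flowFunctionals {ι : Type*} {s : Finset ι} {f : ι → Flow V → ℝ}
    (h : ∀ k ∈ s, f k ∈ flowFunctionals V) :
    (fun x => ∑ k ∈ s, f k x) ∈ flowFunctionals V := by
  have := Submodule.sum_mem (flowFunctionals V) h
  convert this using 1
  ext x
  simp

lemma isLinearMap_of_mem_flowFunctionals {f : Flow V → ℝ} (hf : f ∈ flowFunctionals V) :
    IsLinearMap ℝ f := by
  induction hf using Submodule.span_induction with
  | mem f hf => obtain ⟨k, rfl⟩ := hf; exact ⟨fun _ _ => rfl, fun _ _ => rfl⟩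
  | zero => exact ⟨fun _ _ => by simp, fun _ _ => by simp⟩
  | add f g _ _ hf hg =>
    exact ⟨fun x y => by simp only [Pi.add_apply, hf.map_add, hg.map_add]; ring,
      fun c x => by simp only [Pi.add_apply, hf.map_smul, hg.map_smul, smul_add]⟩
  | smul a f _ hf =>
    exact ⟨fun x y => by simp only [Pi.smul_apply, hf.map_add, smul_add],
      fun c x => by simp only [Pi.smul_apply, hf.map_smul, smul_comm a c]⟩

lemma continuous_of_mem_flowFunctionals {f : Flow V → ℝ} (hf : f ∈ flowFunctionals V) :
    Continuous f := by
  induction hf using Submodule.span_induction with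
  | mem f hf => obtain ⟨k, rfl⟩ := hf; fun_prop
  | zero => exact continuous_const
  | add f g _ _ hf hg => exact hf.add hg
  | smul a f _ hf => exact hf.const_smul a

/-- Induction over the span lets the expectation pass inside throughput, link loads, queue terms and
cost alike. -/
lemma integral_of_mem_flowFunctionals {f : Flow V → ℝ} (hf : f ∈ flowFunctionals V)
    {Ω : Type*} [MeasurableSpace Ω] {P : Measure Ω} {X : Ω → Flow V}
    (hX : ∀ i j l, Integrable (fun ω => X ω i j l) P) :
    Integrable (fun ω => f (X ω)) P ∧ ∫ ω, f (X ω) ∂P = f fun i j l => ∫ ω, X ω i j l ∂P := by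
  induction hf using Submodule.span_induction with
  | mem f hf => obtain ⟨k, rfl⟩ := hf; exact ⟨hX _ _ _, rfl⟩
  | zero => simp
  | add f g _ _ hf hg =>
    exact ⟨hf.1.add hg.1, by simp only [Pi.add_apply, ← hf.2, ← hg.2, integral_add hf.1 hg.1]⟩
  | smul a f _ hf =>
    exact ⟨hf.1.smul a, by simp only [Pi.smul_apply, ← hf.2, integral_smul]⟩

lemma linkFlow_mem_flowFunctionals (N : Network V) (i j : V) :
    (fun x => linkFlow N x i j) ∈ flowFunctionals V :=
  sum_mem_flowFunctionals fun l _ => coord_mem_flowFunctionals i j l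

variable [Fintype V]

lemma outflow_mem_flowFunctionals (i : V) (l : ℕ) :
    (fun x => outflow x i l) ∈ flowFunctionals V :=
  sum_mem_flowFunctionals fun j _ => coord_mem_flowFunctionals i j l

lemma inflow_mem_flowFunctionals (i : V) (l : ℕ) :
    (fun x => inflow x i l) ∈ flowFunctionals V :=
  sum_mem_flowFunctionals fun j _ => coord_mem_flowFunctionals j i l

lemma outflowGe_mem_flowFunctionals (N : Network V) (i : V) (l : ℕ) :
    (fun x => outflowGe N x i l) ∈ flowFunctionals V :=
  sum_mem_flowFunctionals fun m _ => outflow_mem_flowFunctionals i m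

lemma inflowGe_mem_flowFunctionals (N : Network V) (i : V) (l : ℕ) :
    (fun x => inflowGe N x i l) ∈ flowFunctionals V :=
  sum_mem_flowFunctionals fun m _ => inflow_mem_flowFunctionals i m

lemma delivered_mem_flowFunctionals (N : Network V) : delivered N ∈ flowFunctionals V :=
  inflowGe_mem_flowFunctionals N N.dest 1

lemma flowCost_mem_flowFunctionals (N : Network V) : flowCost N ∈ flowFunctionals V :=
  sum_mem_flowFunctionals fun i _ => sum_mem_flowFunctionals fun j _ =>
    Submodule.smul_mem _ (N.cost i j) (linkFlow_mem_flowFunctionals N i j)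

end LinearFunctionals

/-! ### Compactness of the set of admissible flows -/

section FlowFacts

variable {V : Type} {N : Network V}

lemma IsFlow.le_linkFlow {x : Flow V} (hx : IsFlow N x) (i j : V) {l : ℕ}
    (hl : l ∈ Finset.Icc 1 N.L) : x i j l ≤ linkFlow N x i j :=
  Finset.single_le_sum (f := fun l => x i j l) (fun k _ => hx.nonneg i j k) hl

lemma isClosed_setOf_isFlow (N : Network V) : IsClosed {x : Flow V | IsFlow N x} := by
  have : {x : Flow V | IsFlow N x} =
      {x | ∀ i j l, 0 ≤ x i j l} ∩
        {x | ∀ i j l, ¬ (N.graph.Adj i j ∧ l ∈ Finset.Icc 1 N.L) → x i j l = 0} :=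
    Set.ext fun x => ⟨fun h => ⟨h.1, h.2⟩, fun h => ⟨h.1, h.2⟩⟩
  rw [this]
  simp only [Set.ofPred_forall]
  refine IsClosed.inter ?_ ?_ <;>
    refine isClosed_iInter fun i => isClosed_iInter fun j => isClosed_iInter fun l => ?_
  · exact isClosed_le continuous_const (by fun_prop)
  · exact isClosed_iInter fun _ => isClosed_eq (by fun_prop) continuous_const

/-- Flows with values in `[0, B]`. -/
def flowBox (V : Type) (B : ℝ) : Set (Flow V) :=
  Set.univ.pi fun _ => Set.univ.pi fun _ => Set.univ.pi fun _ => Set.Icc 0 B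

lemma mem_flowBox {B : ℝ} {x : Flow V} : x ∈ flowBox V B ↔ ∀ i j l, 0 ≤ x i j l ∧ x i j l ≤ B := by
  simp only [flowBox, Set.mem_univ_pi, Set.mem_Icc]

lemma isCompact_flowBox (B : ℝ) : IsCompact (flowBox V B) :=
  isCompact_univ_pi fun _ => isCompact_univ_pi fun _ => isCompact_univ_pi fun _ => isCompact_Icc

variable [Fintype V]

lemma IsFlow.le_outflow {x : Flow V} (hx : IsFlow N x) (i j : V) (l : ℕ) :
    x i j l ≤ outflow x i l :=
  Finset.single_le_sum (f := fun j => x i j l) (fun k _ => hx.nonneg i k l) (Finset.mem_univ j)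

lemma IsFlow.outflow_nonneg {x : Flow V} (hx : IsFlow N x) (i : V) (l : ℕ) : 0 ≤ outflow x i l :=
  Finset.sum_nonneg fun j _ => hx.nonneg i j l

lemma IsFlow.inflow_nonneg {x : Flow V} (hx : IsFlow N x) (i : V) (l : ℕ) : 0 ≤ inflow x i l :=
  Finset.sum_nonneg fun j _ => hx.nonneg j i l

lemma IsFlow.outflow_eq_zero {x : Flow V} (hx : IsFlow N x) (i : V) {l : ℕ}
    (hl : l ∉ Finset.Icc 1 N.L) : outflow x i l = 0 :=
  Finset.sum_eq_zero fun j _ => hx.support i j l fun h => hl h.2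

lemma IsFlow.inflow_eq_zero {x : Flow V} (hx : IsFlow N x) (i : V) {l : ℕ}
    (hl : l ∉ Finset.Icc 1 N.L) : inflow x i l = 0 :=
  Finset.sum_eq_zero fun j _ => hx.support j i l fun h => hl h.2

lemma cap_le_sum_cap (N : Network V) (i j : V) : (N.cap i j : ℝ) ≤ ∑ i, ∑ j, (N.cap i j : ℝ) :=
  (Finset.single_le_sum (f := fun j => (N.cap i j : ℝ)) (fun j _ => (N.cap i j).2)
    (Finset.mem_univ j)).trans
  (Finset.single_le_sum (f := fun i => ∑ j, (N.cap i j : ℝ))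
    (fun i _ => Finset.sum_nonneg fun j _ => (N.cap i j).2) (Finset.mem_univ i))

/-- Capacities bound the coordinates on links and the others vanish, so Tychonoff applies to a box;
all the conditions are closed. -/
lemma isCompact_setOf_flowConditions (N : Network V) (lam : Rates V) (γ : ℝ) :
    IsCompact {x : Flow V | FlowConditions N lam γ x} := by
  set B : ℝ := ∑ i, ∑ j, (N.cap i j : ℝ) with hB
  have hB0 : 0 ≤ B := Finset.sum_nonneg fun i _ => Finset.sum_nonneg fun j _ => (N.cap i j).2
  have hbox : {x : Flow V | FlowConditions N lam γ x} ⊆ flowBox V B := by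
    intro x hx
    refine mem_flowBox.2 fun i j l => ⟨hx.isFlow.nonneg i j l, ?_⟩
    by_cases h : N.graph.Adj i j ∧ l ∈ Finset.Icc 1 N.L
    · exact (hx.isFlow.le_linkFlow i j h.2).trans ((hx.capacity i j h.1).trans (cap_le_sum_cap N i j))
    · rw [hx.isFlow.support i j l h]; exact hB0
  refine (isCompact_flowBox B).of_isClosed_subset ?_ hbox
  have hset : {x : Flow V | FlowConditions N lam γ x} =
      {x | IsFlow N x} ∩ ({x | γ * rateNorm N lam ≤ delivered N x} ∩
        ({x | ∀ i j, N.graph.Adj i j → linkFlow N x i j ≤ N.cap i j} ∩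
        ({x | ∀ i, ∀ l ∈ Finset.Icc 1 N.L,
          outflowGe N x i l ≤ inflowGe N x i (l + 1) + rateGe N lam i l} ∩
        ({x | ∀ i j, N.graph.Adj i j → x i j 0 = 0} ∩
        {x | ∀ k, N.graph.Adj N.dest k → ∀ l ∈ Finset.Icc 1 N.L, x N.dest k l = 0})))) :=
    Set.ext fun x => ⟨fun h => ⟨h.1, h.2, h.3, h.4, h.5, h.6⟩,
      fun ⟨h1, h2, h3, h4, h5, h6⟩ => ⟨h1, h2, h3, h4, h5, h6⟩⟩
  rw [hset]
  simp only [Set.ofPred_forall]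
  refine (isClosed_setOf_isFlow N).inter (IsClosed.inter ?_ (IsClosed.inter ?_
    (IsClosed.inter ?_ (IsClosed.inter ?_ ?_))))
  · exact isClosed_le continuous_const
      (continuous_of_mem_flowFunctionals (delivered_mem_flowFunctionals N))
  · exact isClosed_iInter fun i => isClosed_iInter fun j => isClosed_iInter fun _ =>
      isClosed_le (continuous_of_mem_flowFunctionals (linkFlow_mem_flowFunctionals N i j))
        continuous_const
  · exact isClosed_iInter fun i => isClosed_iInter fun l => isClosed_iInter fun _ =>
      isClosed_le (continuous_of_mem_flowFunctionals (outflowGe_mem_flowFunctionals N i l))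
        ((continuous_of_mem_flowFunctionals (inflowGe_mem_flowFunctionals N i (l + 1))).add
          continuous_const)
  · exact isClosed_iInter fun i => isClosed_iInter fun j => isClosed_iInter fun _ =>
      isClosed_eq (by fun_prop) continuous_const
  · exact isClosed_iInter fun k => isClosed_iInter fun _ => isClosed_iInter fun l =>
      isClosed_iInter fun _ => isClosed_eq (by fun_prop) continuous_const

/-- The cheapest flow meeting the linear conditions. -/
lemma exists_isMinOn_flowCost {lam : Rates V} {γ : ℝ} (h : ∃ x, FlowConditions N lam γ x) :
    ∃ x, FlowConditions N lam γ x ∧ ∀ y, FlowConditions N lam γ y → flowCost N x ≤ flowCost N y :=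
  (isCompact_setOf_flowConditions N lam γ).exists_isMinOn h
    (continuous_of_mem_flowFunctionals (flowCost_mem_flowFunctionals N)).continuousOn

end FlowFacts

/-! ### Time averages of expected decisions -/

namespace Policy

variable {V : Type} [Fintype V] {N : Network V} {ρ : Measure (Arrivals V)}

/-- The expected decision of slot `t`. -/
def meanFlow (p : Policy N ρ) (t : ℕ) : Flow V := fun i j l => ∫ ω, p.x t ω i j l ∂p.P

/-- The average of the expected decisions of the first `T` slots. -/
def avgFlow (p : Policy N ρ) (T : ℕ) : Flow V :=
  (1 / (T : ℝ)) • ∑ t ∈ Finset.range T, p.meanFlow t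

lemma avgFlow_apply (p : Policy N ρ) (T : ℕ) (i j : V) (l : ℕ) :
    p.avgFlow T i j l = (1 / (T : ℝ)) * ∑ t ∈ Finset.range T, p.meanFlow t i j l := by
  simp [avgFlow, Finset.sum_apply]

lemma apply_avgFlow (p : Policy N ρ) {f : Flow V → ℝ} (hf : f ∈ flowFunctionals V) (T : ℕ) :
    f (p.avgFlow T) = (1 / (T : ℝ)) * ∑ t ∈ Finset.range T, f (p.meanFlow t) := by
  have h := isLinearMap_of_mem_flowFunctionals hf
  have h2 := map_sum (IsLinearMap.mk' f h) p.meanFlow (Finset.range T)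
  simp only [IsLinearMap.mk'_apply] at h2
  rw [avgFlow, h.map_smul, h2, smul_eq_mul]

lemma measurable_decision (p : Policy N ρ) (t : ℕ) (i j : V) (l : ℕ) :
    Measurable fun ω => p.x t ω i j l := by
  have h : Measurable (p.x t) := (p.x_adapted t).mono (p.ℱ.le t) le_rfl
  fun_prop

/-- The decisions are almost surely bounded by `B`. -/
def BoundedBy (p : Policy N ρ) (B : ℝ) : Prop := ∀ᵐ ω ∂p.P, ∀ t i j l, p.x t ω i j l ≤ B

variable {p : Policy N ρ} {B : ℝ}

lemma BoundedBy.integrable (hp : p.BoundedBy B) (t : ℕ) (i j : V) (l : ℕ) :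
    Integrable (fun ω => p.x t ω i j l) p.P := by
  refine Integrable.of_bound (p.measurable_decision t i j l).aestronglyMeasurable B ?_
  filter_upwards [hp, p.x_isFlow] with ω h1 h2
  rw [Real.norm_of_nonneg ((h2 t).nonneg i j l)]
  exact h1 t i j l

lemma BoundedBy.integral_apply (hp : p.BoundedBy B) {f : Flow V → ℝ} (hf : f ∈ flowFunctionals V)
    (t : ℕ) : ∫ ω, f (p.x t ω) ∂p.P = f (p.meanFlow t) :=
  (integral_of_mem_flowFunctionals hf (hp.integrable t)).2

lemma BoundedBy.hasTimeAvg_iff (hp : p.BoundedBy B) {f : Flow V → ℝ} (hf : f ∈ flowFunctionals V)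
    {m : ℝ} : p.HasTimeAvg f m ↔ Tendsto (fun T => f (p.avgFlow T)) atTop (𝓝 m) := by
  simp only [HasTimeAvg, hp.integral_apply hf, p.apply_avgFlow hf]

lemma isFlow_meanFlow (p : Policy N ρ) (t : ℕ) : IsFlow N (p.meanFlow t) where
  nonneg i j l := integral_nonneg_of_ae <| by
    filter_upwards [p.x_isFlow] with ω h using (h t).nonneg i j l
  support i j l hl := integral_eq_zero_of_ae <| by
    filter_upwards [p.x_isFlow] with ω h using (h t).support i j l hl

lemma isFlow_avgFlow (p : Policy N ρ) (T : ℕ) : IsFlow N (p.avgFlow T) where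
  nonneg i j l := by
    rw [avgFlow_apply]
    exact mul_nonneg (by positivity)
      (Finset.sum_nonneg fun t _ => (p.isFlow_meanFlow t).nonneg i j l)
  support i j l hl := by
    rw [avgFlow_apply, Finset.sum_eq_zero fun t _ => (p.isFlow_meanFlow t).support i j l hl,
      mul_zero]

lemma BoundedBy.meanFlow_le (hp : p.BoundedBy B) (t : ℕ) (i j : V) (l : ℕ) :
    p.meanFlow t i j l ≤ B := by
  have : p.meanFlow t i j l ≤ ∫ _, B ∂p.P := by
    refine integral_mono_ae (hp.integrable t i j l) (integrable_const B) ?_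
    filter_upwards [hp] with ω h using h t i j l
  simpa using this

lemma average_le {u : ℕ → ℝ} (hB : 0 ≤ B) (hu : ∀ t, u t ≤ B) (T : ℕ) :
    (1 / (T : ℝ)) * ∑ t ∈ Finset.range T, u t ≤ B := by
  rcases Nat.eq_zero_or_pos T with rfl | hT
  · simpa using hB
  · have hT' : (0 : ℝ) < T := by exact_mod_cast hT
    rw [one_div, inv_mul_le_iff₀ hT']
    simpa using Finset.sum_le_card_nsmul (Finset.range T) u B fun t _ => hu t

/-- The average flows accumulate at some flow. -/
lemma BoundedBy.exists_limit (hp : p.BoundedBy B) (hB : 0 ≤ B) :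
    ∃ x : Flow V, IsFlow N x ∧ Tendsto p.avgFlow (hyperfilter ℕ) (𝓝 x) := by
  have hmem : ∀ T, p.avgFlow T ∈ flowBox V B := fun T => mem_flowBox.2 fun i j l =>
    ⟨(p.isFlow_avgFlow T).nonneg i j l, by
      rw [avgFlow_apply]; exact average_le hB (fun t => hp.meanFlow_le t i j l) T⟩
  -- The hyperfilter replaces a convergent subsequence and serves all coordinates at once.
  obtain ⟨x, -, hx⟩ := (isCompact_flowBox (V := V) B).ultrafilter_le_nhds
    ((hyperfilter ℕ).map p.avgFlow)
    (le_principal_iff.2 (Filter.mem_map.2 (univ_mem' hmem)))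
  exact ⟨x, (isClosed_setOf_isFlow N).mem_of_tendsto hx
    (Eventually.of_forall fun T => p.isFlow_avgFlow T), hx⟩

lemma tendsto_apply_limit {x : Flow V} (hx : Tendsto p.avgFlow (hyperfilter ℕ) (𝓝 x))
    {f : Flow V → ℝ} (hf : f ∈ flowFunctionals V) :
    Tendsto (fun T => f (p.avgFlow T)) (hyperfilter ℕ) (𝓝 (f x)) :=
  ((continuous_of_mem_flowFunctionals hf).tendsto x).comp hx

/-- The hyperfilter is finer than `atTop`, so a genuine limit must agree with the one along it.
Functionals without a time average still have a value at `x`. -/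
lemma BoundedBy.apply_limit (hp : p.BoundedBy B) {x : Flow V}
    (hx : Tendsto p.avgFlow (hyperfilter ℕ) (𝓝 x)) {f : Flow V → ℝ} (hf : f ∈ flowFunctionals V)
    {m : ℝ} (hm : p.HasTimeAvg f m) : f x = m :=
  tendsto_nhds_unique (tendsto_apply_limit hx hf)
    (((hp.hasTimeAvg_iff hf).1 hm).mono_left Nat.hyperfilter_le_atTop)

lemma BoundedBy.hasTimeAvg_of_eventually (hp : p.BoundedBy B) {x : Flow V}
    (hx : ∀ᶠ t in atTop, p.meanFlow t = x) {f : Flow V → ℝ} (hf : f ∈ flowFunctionals V) :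
    p.HasTimeAvg f (f x) := by
  simp only [HasTimeAvg, hp.integral_apply hf, one_div]
  refine Tendsto.cesaro (u := fun t => f (p.meanFlow t)) ?_
  exact tendsto_const_nhds.congr' (hx.mono fun t ht => congrArg f ht.symm)

end Policy

/-! ### Tail sums over lifetimes and the stationary backlog -/

section GeSums

variable {V : Type} {N : Network V}

lemma rateGe_eq_add (lam : Rates V) (i : V) {l : ℕ} (hl : l ≤ N.L) :
    rateGe N lam i l = lam i l + rateGe N lam i (l + 1) := by
  rw [rateGe, ← Finset.insert_Icc_add_one_left_eq_Icc hl, Finset.sum_insert (by simp), rateGe]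

variable [Fintype V]

lemma IsFlow.inflowGe_eq_add {x : Flow V} (hx : IsFlow N x) (i : V) (l : ℕ) :
    inflowGe N x i l = inflow x i l + inflowGe N x i (l + 1) := by
  by_cases hl : l ≤ N.L
  · rw [inflowGe, ← Finset.insert_Icc_add_one_left_eq_Icc hl, Finset.sum_insert (by simp), inflowGe]
  · rw [hx.inflow_eq_zero i (by simp; omega), inflowGe, inflowGe, Finset.Icc_eq_empty (by omega),
      Finset.Icc_eq_empty (by omega)]
    simp

lemma IsFlow.outflowGe_eq_add {x : Flow V} (hx : IsFlow N x) (i : V) (l : ℕ) :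
    outflowGe N x i l = outflow x i l + outflowGe N x i (l + 1) := by
  by_cases hl : l ≤ N.L
  · rw [outflowGe, ← Finset.insert_Icc_add_one_left_eq_Icc hl, Finset.sum_insert (by simp),
      outflowGe]
  · rw [hx.outflow_eq_zero i (by simp; omega), outflowGe, outflowGe,
      Finset.Icc_eq_empty (by omega), Finset.Icc_eq_empty (by omega)]
    simp

/-- The mean backlog of lifetime `l` at node `i` in the stationary regime with mean flow `x`. -/
def stationaryBacklog (N : Network V) (lam : Rates V) (x : Flow V) (i : V) (l : ℕ) : ℝ :=
  inflowGe N x i (l + 1) + rateGe N lam i l - outflowGe N x i (l + 1)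

lemma stationaryBacklog_of_gt (lam : Rates V) (x : Flow V) (i : V) {l : ℕ} (hl : N.L < l) :
    stationaryBacklog N lam x i l = 0 := by
  simp [stationaryBacklog, inflowGe, outflowGe, rateGe, Finset.Icc_eq_empty, hl.not_ge,
    (Nat.lt_succ_of_lt hl).not_ge]

lemma IsFlow.stationaryBacklog_eq {x : Flow V} (hx : IsFlow N x) (lam : Rates V) (i : V) {l : ℕ}
    (hl : l ≤ N.L) : stationaryBacklog N lam x i l =
      stationaryBacklog N lam x i (l + 1) - outflow x i (l + 1) + inflow x i (l + 1) + lam i l := by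
  rw [stationaryBacklog, stationaryBacklog, hx.inflowGe_eq_add i (l + 1),
    hx.outflowGe_eq_add i (l + 1), rateGe_eq_add lam i hl]
  ring

end GeSums

/-! ### Uniform bounds on backlogs -/

section QueueBounds

variable {V : Type} [Fintype V]

lemma sum_inflow (x : Flow V) (l : ℕ) : ∑ i, inflow x i l = ∑ i, outflow x i l :=
  Finset.sum_comm

variable [DecidableEq V] {N : Network V}

lemma queue_of_or (a : ℕ → Arrivals V) (x : ℕ → Flow V) (t : ℕ) {i : V} {l : ℕ}
    (h : i = N.dest ∨ l ∉ Finset.Icc 1 N.L) : queue N a x t i l = 0 := by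
  cases t with
  | zero => rfl
  | succ t => simp only [queue, if_pos h]

lemma queue_succ (a : ℕ → Arrivals V) (x : ℕ → Flow V) (t : ℕ) {i : V} {l : ℕ}
    (h : ¬ (i = N.dest ∨ l ∉ Finset.Icc 1 N.L)) : queue N a x (t + 1) i l =
      queue N a x t i (l + 1) - outflow (x t) i (l + 1) + inflow (x t) i (l + 1) + a t i l := by
  simp only [queue, if_neg h]

variable {a : ℕ → Arrivals V} {x : ℕ → Flow V}

lemma outflow_le_queue (hx : ∀ t, IsFlow N (x t))
    (hav : ∀ t i, ∀ l ∈ Finset.Icc 1 N.L, outflow (x t) i l ≤ queue N a x t i l)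
    (t : ℕ) (i : V) (l : ℕ) : outflow (x t) i l ≤ queue N a x t i l := by
  by_cases hl : l ∈ Finset.Icc 1 N.L
  · exact hav t i l hl
  · rw [(hx t).outflow_eq_zero i hl, queue_of_or a x t (Or.inr hl)]

/-- Summed over the nodes, transfers cancel: total backlog of lifetime `l` is at most that of
lifetime `l + 1` one slot earlier plus new arrivals. At most `L + 1 - l` generations of arrivals
contribute. -/
lemma sum_queue_le (hx : ∀ t, IsFlow N (x t))
    (hav : ∀ t i, ∀ l ∈ Finset.Icc 1 N.L, outflow (x t) i l ≤ queue N a x t i l)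
    {A : ℕ} (ha : ∀ t i l, a t i l ≤ A) (t l : ℕ) :
    ∑ i, queue N a x t i l ≤ ((N.L + 1 - l : ℕ) : ℝ) * (Fintype.card V * A) := by
  induction t generalizing l with
  | zero => simp only [queue, Finset.sum_const_zero]; positivity
  | succ t ih =>
    by_cases hl : l ∈ Finset.Icc 1 N.L
    · have hl' := Finset.mem_Icc.1 hl
      have hstep : ∀ i, queue N a x (t + 1) i l ≤
          queue N a x t i (l + 1) - outflow (x t) i (l + 1) + inflow (x t) i (l + 1) + A := by
        intro i
        -- The destination's queue is emptied rather than updated; the right-hand side is still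
        -- nonnegative there because outflow does not exceed backlog.
        by_cases hi : i = N.dest
        · rw [queue_of_or a x (t + 1) (Or.inl hi)]
          have h1 := outflow_le_queue hx hav t i (l + 1)
          have h2 := (hx t).inflow_nonneg i (l + 1)
          have h3 : (0 : ℝ) ≤ A := by positivity
          linarith
        · rw [queue_succ a x t (by simp only [not_or, not_not]; exact ⟨hi, hl⟩)]
          have : (a t i l : ℝ) ≤ A := by exact_mod_cast ha t i l
          linarith
      calc ∑ i, queue N a x (t + 1) i l
          ≤ ∑ i, (queue N a x t i (l + 1) - outflow (x t) i (l + 1) +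
              inflow (x t) i (l + 1) + A) := Finset.sum_le_sum fun i _ => hstep i
        _ = ∑ i, queue N a x t i (l + 1) + Fintype.card V * A := by
            rw [Finset.sum_add_distrib, Finset.sum_add_distrib, Finset.sum_sub_distrib, sum_inflow]
            simp
        _ ≤ ((N.L + 1 - (l + 1) : ℕ) : ℝ) * (Fintype.card V * A) + Fintype.card V * A := by
            gcongr; exact ih (l + 1)
        _ = ((N.L + 1 - l : ℕ) : ℝ) * (Fintype.card V * A) := by
            rw [show N.L + 1 - l = N.L + 1 - (l + 1) + 1 by omega]
            push_cast
            ring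
    · rw [Finset.sum_eq_zero fun i _ => queue_of_or a x (t + 1) (Or.inr hl)]
      positivity

lemma queue_le (hx : ∀ t, IsFlow N (x t))
    (hav : ∀ t i, ∀ l ∈ Finset.Icc 1 N.L, outflow (x t) i l ≤ queue N a x t i l)
    {A : ℕ} (ha : ∀ t i l, a t i l ≤ A) (t : ℕ) (i : V) (l : ℕ) :
    queue N a x t i l ≤ ((N.L + 1 : ℕ) : ℝ) * (Fintype.card V * A) := by
  have h0 : ∀ i, 0 ≤ queue N a x t i l := fun i =>
    ((hx t).outflow_nonneg i l).trans (outflow_le_queue hx hav t i l)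
  refine (Finset.single_le_sum (f := fun i => queue N a x t i l) (fun i _ => h0 i)
    (Finset.mem_univ i)).trans ((sum_queue_le hx hav ha t l).trans ?_)
  gcongr
  omega

end QueueBounds

/-! ### Mean arrival rates -/

section MeanRate

variable {V : Type} {N : Network V} {ρ : Measure (Arrivals V)}

lemma measurable_arrival (i : V) (l : ℕ) : Measurable fun a : Arrivals V => (a i l : ℝ) :=
  (measurable_from_top (f := fun n : ℕ => (n : ℝ))).comp
    ((measurable_pi_apply l).comp (measurable_pi_apply i))

lemma IsArrivalLaw.integrable (h : IsArrivalLaw N ρ) (i : V) (l : ℕ) :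
    Integrable (fun a : Arrivals V => (a i l : ℝ)) ρ := by
  have := h.prob
  obtain ⟨A, hA⟩ := h.bounded
  refine Integrable.of_bound (measurable_arrival i l).aestronglyMeasurable A ?_
  filter_upwards [hA] with a ha
  simpa using ha i l

lemma IsArrivalLaw.isRate (h : IsArrivalLaw N ρ) : IsRate N (meanRate ρ) where
  nonneg i l := integral_nonneg fun a => by positivity
  support i l hl := integral_eq_zero_of_ae <| by
    filter_upwards [h.support] with a ha
    simp [ha i l hl]

end MeanRate

/-! ### Expected backlogs and their averages -/

namespace Policy

variable {V : Type} [Fintype V] {N : Network V} {ρ : Measure (Arrivals V)} (p : Policy N ρ)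

lemma measurable_a (t : ℕ) : Measurable (p.a t) := (p.a_adapted t).mono (p.ℱ.le _) le_rfl

lemma integrable_arrival (h : IsArrivalLaw N ρ) (t : ℕ) (i : V) (l : ℕ) :
    Integrable (fun ω => (p.a t ω i l : ℝ)) p.P := by
  have := h.integrable i l
  rw [← p.a_law t] at this
  exact this.comp_measurable (p.measurable_a t)

lemma integral_arrival (t : ℕ) (i : V) (l : ℕ) :
    ∫ ω, (p.a t ω i l : ℝ) ∂p.P = meanRate ρ i l := by
  have := integral_map (μ := p.P) (p.measurable_a t).aemeasurable
    (measurable_arrival i l).aestronglyMeasurable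
  rw [p.a_law t] at this
  exact this.symm

lemma ae_arrival_le (h : IsArrivalLaw N ρ) :
    ∃ A : ℕ, ∀ᵐ ω ∂p.P, ∀ t i l, p.a t ω i l ≤ A := by
  obtain ⟨A, hA⟩ := h.bounded
  refine ⟨A, ae_all_iff.2 fun t => ?_⟩
  rw [← p.a_law t] at hA
  exact ae_of_ae_map (p.measurable_a t).aemeasurable hA

variable [DecidableEq V]

/-- No more packets are sent than are queued. -/
def Available : Prop := ∀ᵐ ω ∂p.P, ∀ t i, ∀ l ∈ Finset.Icc 1 N.L,
    outflow (p.x t ω) i l ≤ p.backlog t i l ω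

/-- The expected backlog. -/
def meanBacklog (t : ℕ) (i : V) (l : ℕ) : ℝ := ∫ ω, p.backlog t i l ω ∂p.P

lemma measurable_backlog (t : ℕ) (i : V) (l : ℕ) : Measurable (p.backlog t i l) := by
  induction t generalizing i l with
  | zero => exact measurable_const
  | succ t ih =>
    by_cases h : i = N.dest ∨ l ∉ Finset.Icc 1 N.L
    · rw [show p.backlog (t + 1) i l = fun _ => 0 from funext fun ω => queue_of_or _ _ _ h]
      exact measurable_const
    · rw [show p.backlog (t + 1) i l = fun ω => p.backlog t i (l + 1) ω -
          outflow (p.x t ω) i (l + 1) + inflow (p.x t ω) i (l + 1) + p.a t ω i l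
        from funext fun ω => queue_succ _ _ _ h]
      exact (((ih i (l + 1)).sub
        (Finset.measurable_fun_sum _ fun j _ => p.measurable_decision t i j (l + 1))).add
        (Finset.measurable_fun_sum _ fun j _ => p.measurable_decision t j i (l + 1))).add
        ((measurable_arrival i l).comp (p.measurable_a t))

variable {p}

lemma Available.exists_bound (hp : p.Available) (h : IsArrivalLaw N ρ) :
    ∃ B : ℝ, 0 ≤ B ∧ ∀ᵐ ω ∂p.P, ∀ t i l,
      outflow (p.x t ω) i l ≤ p.backlog t i l ω ∧ p.backlog t i l ω ≤ B := by
  obtain ⟨A, hA⟩ := p.ae_arrival_le h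
  refine ⟨((N.L + 1 : ℕ) : ℝ) * (Fintype.card V * A), by positivity, ?_⟩
  filter_upwards [hp, hA, p.x_isFlow] with ω h1 h2 h3 t i l
  exact ⟨outflow_le_queue h3 h1 t i l, queue_le h3 h1 h2 t i l⟩

lemma Available.exists_boundedBy (hp : p.Available) (h : IsArrivalLaw N ρ) :
    ∃ B, 0 ≤ B ∧ p.BoundedBy B := by
  obtain ⟨B, hB, hb⟩ := hp.exists_bound h
  refine ⟨B, hB, ?_⟩
  filter_upwards [hb, p.x_isFlow] with ω h1 h2 t i j l
  exact ((h2 t).le_outflow i j l).trans ((h1 t i l).1.trans (h1 t i l).2)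

lemma Available.integrable_backlog (hp : p.Available) (h : IsArrivalLaw N ρ) (t : ℕ) (i : V)
    (l : ℕ) : Integrable (p.backlog t i l) p.P := by
  obtain ⟨B, hB, hb⟩ := hp.exists_bound h
  refine Integrable.of_bound (p.measurable_backlog t i l).aestronglyMeasurable B ?_
  filter_upwards [hb, p.x_isFlow] with ω h1 h2
  rw [Real.norm_of_nonneg (((h2 t).outflow_nonneg i l).trans (h1 t i l).1)]
  exact (h1 t i l).2

lemma Available.exists_meanBacklog_bound (hp : p.Available) (h : IsArrivalLaw N ρ) :
    ∃ B : ℝ, ∀ t i l,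
      outflow (p.meanFlow t) i l ≤ p.meanBacklog t i l ∧ p.meanBacklog t i l ≤ B := by
  obtain ⟨B, hB, hb⟩ := hp.exists_bound h
  obtain ⟨B', -, hB'⟩ := hp.exists_boundedBy h
  refine ⟨B, fun t i l => ⟨?_, ?_⟩⟩
  · rw [← hB'.integral_apply (outflow_mem_flowFunctionals i l)]
    refine integral_mono_ae (integral_of_mem_flowFunctionals (outflow_mem_flowFunctionals i l)
      (hB'.integrable t)).1 (hp.integrable_backlog h t i l) ?_
    filter_upwards [hb] with ω h1 using (h1 t i l).1
  · have : p.meanBacklog t i l ≤ ∫ _, B ∂p.P := by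
      refine integral_mono_ae (hp.integrable_backlog h t i l) (integrable_const B) ?_
      filter_upwards [hb] with ω h1 using (h1 t i l).2
    simpa using this

lemma Available.meanBacklog_succ (hp : p.Available) (h : IsArrivalLaw N ρ) (t : ℕ) {i : V}
    {l : ℕ} (hil : ¬ (i = N.dest ∨ l ∉ Finset.Icc 1 N.L)) : p.meanBacklog (t + 1) i l =
      p.meanBacklog t i (l + 1) - outflow (p.meanFlow t) i (l + 1) +
        inflow (p.meanFlow t) i (l + 1) + meanRate ρ i l := by
  obtain ⟨B, -, hB⟩ := hp.exists_boundedBy h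
  have ho := outflow_mem_flowFunctionals i (l + 1)
  have hi := inflow_mem_flowFunctionals i (l + 1)
  have h1 := hp.integrable_backlog h t i (l + 1)
  have h2 := (integral_of_mem_flowFunctionals ho (hB.integrable t)).1
  have h3 := (integral_of_mem_flowFunctionals hi (hB.integrable t)).1
  have h12 : Integrable (fun ω => p.backlog t i (l + 1) ω - outflow (p.x t ω) i (l + 1)) p.P :=
    h1.sub h2
  have h123 : Integrable (fun ω => p.backlog t i (l + 1) ω - outflow (p.x t ω) i (l + 1) +
      inflow (p.x t ω) i (l + 1)) p.P := h12.add h3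
  rw [← hB.integral_apply ho, ← hB.integral_apply hi, ← p.integral_arrival t, meanBacklog,
    meanBacklog, ← integral_sub h1 h2, ← integral_add h12 h3,
    ← integral_add h123 (p.integrable_arrival h t i l)]
  exact integral_congr_ae (Eventually.of_forall fun ω => queue_succ _ _ _ hil)

lemma meanBacklog_of_or (t : ℕ) {i : V} {l : ℕ} (hil : i = N.dest ∨ l ∉ Finset.Icc 1 N.L) :
    p.meanBacklog t i l = 0 :=
  integral_eq_zero_of_ae (Eventually.of_forall fun _ => queue_of_or _ _ _ hil)

/-- Along an accumulation point of the average flows, the average backlogs converge. -/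
lemma Available.tendsto_meanBacklog (hp : p.Available) (h : IsArrivalLaw N ρ) {x : Flow V}
    (hxf : IsFlow N x) (hx : Tendsto p.avgFlow (hyperfilter ℕ) (𝓝 x)) {i : V} (hi : i ≠ N.dest)
    (k : ℕ) : ∀ l, 1 ≤ l → l + k = N.L + 1 →
    Tendsto (fun T : ℕ => (1 / (T : ℝ)) * ∑ t ∈ Finset.range T, p.meanBacklog t i l)
      (hyperfilter ℕ) (𝓝 (stationaryBacklog N (meanRate ρ) x i l)) := by
  induction k with
  | zero =>
    intro l _ hl
    rw [stationaryBacklog_of_gt _ _ _ (by omega : N.L < l)]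
    refine tendsto_const_nhds.congr fun T => ?_
    rw [Finset.sum_eq_zero fun t _ => meanBacklog_of_or t (Or.inr (by simp; omega)), mul_zero]
  | succ k ih =>
    intro l hl1 hl
    have hil : ¬ (i = N.dest ∨ l ∉ Finset.Icc 1 N.L) := by
      simp only [not_or, not_not, Finset.mem_Icc]
      exact ⟨hi, hl1, by omega⟩
    obtain ⟨B, hB⟩ := hp.exists_meanBacklog_bound h
    have ho := outflow_mem_flowFunctionals i (l + 1)
    have hin := inflow_mem_flowFunctionals i (l + 1)
    have hinv : Tendsto (fun T : ℕ => 1 / (T : ℝ)) (hyperfilter ℕ) (𝓝 0) :=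
      tendsto_one_div_atTop_nhds_zero_nat.mono_left Nat.hyperfilter_le_atTop
    -- Boundary term of the index shift below: bounded backlog divided by `T`.
    have hsmall : Tendsto (fun T : ℕ => 1 / (T : ℝ) * p.meanBacklog T i l)
        (hyperfilter ℕ) (𝓝 0) := by
      have h0 : ∀ t, 0 ≤ p.meanBacklog t i l := fun t =>
        ((p.isFlow_meanFlow t).outflow_nonneg i l).trans (hB t i l).1
      refine squeeze_zero (fun T => mul_nonneg (by positivity) (h0 T))
        (fun T => mul_le_mul_of_nonneg_left (hB T i l).2 (by positivity))
        (by simpa using hinv.mul_const B)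
    have hlim := ((((ih (l + 1) (by omega) (by omega)).sub (tendsto_apply_limit hx ho)).add
      (tendsto_apply_limit hx hin)).add_const (meanRate ρ i l)).sub hsmall
    rw [hxf.stationaryBacklog_eq _ _ (by omega)]
    rw [sub_zero] at hlim
    refine hlim.congr' ?_
    have hpos : ∀ᶠ T : ℕ in hyperfilter ℕ, 0 < T :=
      (eventually_gt_atTop 0).filter_mono Nat.hyperfilter_le_atTop
    filter_upwards [hpos] with T hT
    have hT' : (T : ℝ) ≠ 0 := by positivity
    -- The shift loses nothing at `t = 0` because the queues start empty.
    have hsum : ∑ t ∈ Finset.range T, p.meanBacklog t i l + p.meanBacklog T i l =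
        ∑ t ∈ Finset.range T, p.meanBacklog (t + 1) i l := by
      rw [← Finset.sum_range_succ, Finset.sum_range_succ']
      simp [meanBacklog, backlog, queue]
    rw [← eq_sub_iff_add_eq] at hsum
    rw [hsum, p.apply_avgFlow ho, p.apply_avgFlow hin]
    simp only [hp.meanBacklog_succ h _ hil, Finset.sum_add_distrib, Finset.sum_sub_distrib,
      Finset.sum_const, Finset.card_range, nsmul_eq_mul]
    field_simp

end Policy

/-! ### Feasible policies yield admissible flows -/

section Necessity

variable {V : Type} [Fintype V] {N : Network V} {ρ : Measure (Arrivals V)} {p : Policy N ρ} {γ : ℝ}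

lemma Policy.Feasible₁.exists_flowConditions [DecidableEq V] (hρ : IsArrivalLaw N ρ)
    (hp : p.Feasible₁ γ) : ∃ x, FlowConditions N (meanRate ρ) γ x ∧
      ∀ c, p.HasCost c → flowCost N x = c := by
  have hav : p.Available := hp.availability
  obtain ⟨B, hB0, hB⟩ := hav.exists_boundedBy hρ
  obtain ⟨x, hxf, hx⟩ := hB.exists_limit hB0
  obtain ⟨B', hB'⟩ := hav.exists_meanBacklog_bound hρ
  -- Silence of the destination is not assumed in the actual problem: it follows from availability,
  -- as the destination's queue is always zero.
  have hout : ∀ l ∈ Finset.Icc 1 N.L, outflow x N.dest l = 0 := by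
    intro l hl
    refine tendsto_nhds_unique (Policy.tendsto_apply_limit hx (outflow_mem_flowFunctionals _ l))
      (tendsto_const_nhds.congr fun T => ?_)
    rw [p.apply_avgFlow (outflow_mem_flowFunctionals _ l), Finset.sum_eq_zero, mul_zero]
    intro t _
    refine le_antisymm ?_ ((p.isFlow_meanFlow t).outflow_nonneg _ l)
    rw [← Policy.meanBacklog_of_or (p := p) t (Or.inl rfl)]
    exact (hB' t N.dest l).1
  refine ⟨x, ⟨hxf, ?_, ?_, ?_, fun i j _ => hxf.support i j 0 (by simp), ?_⟩, fun c hc =>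
    hB.apply_limit hx (flowCost_mem_flowFunctionals N) hc⟩
  · obtain ⟨r, hr, hle⟩ := hp.reliable
    rwa [hB.apply_limit hx (delivered_mem_flowFunctionals N) hr]
  · intro i j hij
    obtain ⟨c, hc, hle⟩ := hp.avg_capacity i j hij
    rwa [hB.apply_limit hx (linkFlow_mem_flowFunctionals N i j) hc]
  · intro i l hl
    have hl' := Finset.mem_Icc.1 hl
    by_cases hi : i = N.dest
    · rw [outflowGe, Finset.sum_eq_zero fun m hm => ?_]
      · exact add_nonneg (Finset.sum_nonneg fun m _ => hxf.inflow_nonneg i m)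
          (Finset.sum_nonneg fun m _ => hρ.isRate.nonneg i m)
      · rw [hi]
        exact hout m (Finset.Icc_subset_Icc_left hl'.1 hm)
    · have h1 := hav.tendsto_meanBacklog hρ hxf hx hi (N.L + 1 - l) l hl'.1 (by omega)
      have h2 := Policy.tendsto_apply_limit hx (outflow_mem_flowFunctionals i l)
      have h3 := le_of_tendsto_of_tendsto' h2 h1 fun T => by
        rw [p.apply_avgFlow (outflow_mem_flowFunctionals i l)]
        exact mul_le_mul_of_nonneg_left (Finset.sum_le_sum fun t _ => (hB' t i l).1)
          (by positivity)
      -- Splitting lifetime `l` off `outflowGe` turns "outflow at most stationary backlog" into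
      -- conservation.
      rw [stationaryBacklog] at h3
      rw [hxf.outflowGe_eq_add]
      linarith
  · intro k _ l hl
    exact le_antisymm (by rw [← hout l hl]; exact hxf.le_outflow N.dest k l) (hxf.nonneg _ _ _)

lemma Policy.Feasible₂.exists_boundedBy (hp : p.Feasible₂ γ) : ∃ B, 0 ≤ B ∧ p.BoundedBy B := by
  have h0 : 0 ≤ ∑ i, ∑ j, (N.cap i j : ℝ) :=
    Finset.sum_nonneg fun i _ => Finset.sum_nonneg fun j _ => (N.cap i j).2
  refine ⟨∑ i, ∑ j, (N.cap i j : ℝ), h0, ?_⟩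
  filter_upwards [hp.peak_capacity, p.x_isFlow] with ω h1 h2 t i j l
  by_cases h : N.graph.Adj i j ∧ l ∈ Finset.Icc 1 N.L
  · exact ((h2 t).le_linkFlow i j h.2).trans ((h1 t i j h.1).trans (cap_le_sum_cap N i j))
  · rw [(h2 t).support i j l h]; exact h0

lemma Policy.Feasible₂.exists_flowConditions (hp : p.Feasible₂ γ) :
    ∃ x, FlowConditions N (meanRate ρ) γ x ∧ ∀ c, p.HasCost c → flowCost N x = c := by
  obtain ⟨B, hB0, hB⟩ := hp.exists_boundedBy
  obtain ⟨x, hxf, hx⟩ := hB.exists_limit hB0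
  refine ⟨x, ⟨hxf, ?_, ?_, ?_, fun i j _ => hxf.support i j 0 (by simp), ?_⟩, fun c hc =>
    hB.apply_limit hx (flowCost_mem_flowFunctionals N) hc⟩
  · obtain ⟨r, hr, hle⟩ := hp.reliable
    rwa [hB.apply_limit hx (delivered_mem_flowFunctionals N) hr]
  · intro i j hij
    have hf := linkFlow_mem_flowFunctionals N i j
    refine le_of_tendsto' (Policy.tendsto_apply_limit hx hf) fun T => ?_
    rw [p.apply_avgFlow hf]
    refine Policy.average_le (N.cap i j).2 (fun t => ?_) T
    rw [← hB.integral_apply hf]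
    have : ∫ ω, linkFlow N (p.x t ω) i j ∂p.P ≤ ∫ _, (N.cap i j : ℝ) ∂p.P := by
      refine integral_mono_ae (integral_of_mem_flowFunctionals hf (hB.integrable t)).1
        (integrable_const _) ?_
      filter_upwards [hp.peak_capacity] with ω h using h t i j hij
    simpa using this
  · intro i l hl
    obtain ⟨o, ι, ho, hι, hle⟩ := hp.causality i l hl
    rwa [hB.apply_limit hx (outflowGe_mem_flowFunctionals N i l) ho,
      hB.apply_limit hx (inflowGe_mem_flowFunctionals N i (l + 1)) hι]
  · intro k hk l hl
    refine tendsto_nhds_unique (Policy.tendsto_apply_limit hx (coord_mem_flowFunctionals _ k l))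
      (tendsto_const_nhds.congr fun T => ?_)
    rw [p.avgFlow_apply, Finset.sum_eq_zero, mul_zero]
    intro t _
    refine integral_eq_zero_of_ae ?_
    filter_upwards [hp.dest_silent] with ω h using h t k hk l hl

end Necessity

/-! ### Arrival laws with prescribed means -/

section LawExistence

variable {V : Type} {N : Network V}

lemma integral_floor_add_indicator {r : ℝ} (hr : 0 ≤ r) :
    ∫ u in Set.Ico (0 : ℝ) 1, ((⌊r⌋₊ + if u < Int.fract r then 1 else 0 : ℕ) : ℝ) = r := by
  have h1 : ∀ u : ℝ, ((⌊r⌋₊ + if u < Int.fract r then 1 else 0 : ℕ) : ℝ) =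
      ⌊r⌋₊ + (Set.Iio (Int.fract r)).indicator (fun _ => (1 : ℝ)) u := by
    intro u
    by_cases h : u < Int.fract r <;> simp [h]
  have h2 : Set.Iio (Int.fract r) ∩ Set.Ico (0 : ℝ) 1 = Set.Ico 0 (Int.fract r) := by
    ext u
    simp only [Set.mem_inter_iff, Set.mem_Iio, Set.mem_Ico]
    have := Int.fract_lt_one r
    constructor
    · rintro ⟨h, h', -⟩; exact ⟨h', h⟩
    · rintro ⟨h, h'⟩; exact ⟨h', h, h'.trans this⟩
  simp only [h1]
  rw [integral_add (integrable_const _) ((integrable_const _).indicator measurableSet_Iio),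
    integral_indicator_const _ measurableSet_Iio, measureReal_restrict_apply measurableSet_Iio, h2]
  simp only [integral_const, measureReal_restrict_apply_univ, Real.volume_real_Ico]
  rw [max_eq_left (by norm_num), max_eq_left (by simp)]
  have h3 := Int.floor_add_fract r
  rw [← natCast_floor_eq_intCast_floor hr] at h3
  simpa using h3

/-- Every rate vector is the mean of some arrival law: round up or down by a common uniform
variable. -/
lemma exists_isArrivalLaw [Finite V] {lam : Rates V} (h : IsRate N lam) :
    ∃ ρ, IsArrivalLaw N ρ ∧ meanRate ρ = lam := by
  let f : ℝ → Arrivals V := fun u i l => ⌊lam i l⌋₊ + if u < Int.fract (lam i l) then 1 else 0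
  have hf : Measurable f := by
    refine measurable_pi_lambda _ fun i => measurable_pi_lambda _ fun l => ?_
    exact measurable_const.add (Measurable.ite measurableSet_Iio measurable_const measurable_const)
  have hm : ∀ i l, ∫ u in Set.Ico (0 : ℝ) 1, (f u i l : ℝ) = lam i l :=
    fun i l => integral_floor_add_indicator (h.nonneg i l)
  have hprob : IsProbabilityMeasure (volume.restrict (Set.Ico (0 : ℝ) 1)) := ⟨by simp⟩
  refine ⟨(volume.restrict (Set.Ico (0 : ℝ) 1)).map f,
    ⟨Measure.isProbabilityMeasure_map hf.aemeasurable, ?_, ?_⟩, ?_⟩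
  -- Only finitely many pairs have a lifetime in `1, …, L`; at all other pairs the rate is zero.
  · have hfin : ((fun q : V × ℕ => ⌊lam q.1 q.2⌋₊ + 1) ''
        (Set.univ ×ˢ (Finset.Icc 1 N.L : Set ℕ))).Finite :=
      (Set.finite_univ.prod (Finset.finite_toSet _)).image _
    obtain ⟨A, hA⟩ := hfin.bddAbove
    refine ⟨A + 1, ?_⟩
    have hbd : ∀ u i l, f u i l ≤ A + 1 := by
      intro u i l
      have h1 : f u i l ≤ ⌊lam i l⌋₊ + 1 := by
        simp only [f]
        split_ifs <;> omega
      by_cases hl : l ∈ Finset.Icc 1 N.L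
      · have := hA ⟨(i, l), ⟨Set.mem_univ _, hl⟩, rfl⟩
        simp only at this
        omega
      · rw [h.support i l (Or.inr hl)] at h1
        simp only [Nat.floor_zero] at h1
        omega
    have hmeas : MeasurableSet {a : Arrivals V | ∀ i l, a i l ≤ A + 1} := by
      simp only [Set.ofPred_forall]
      refine MeasurableSet.iInter fun i => MeasurableSet.iInter fun l => ?_
      exact measurableSet_le
        ((measurable_pi_apply l).comp (measurable_pi_apply i)) measurable_const
    rw [ae_map_iff hf.aemeasurable hmeas]
    exact Eventually.of_forall hbd
  · have hmeas : MeasurableSet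
        {a : Arrivals V | ∀ i l, (i = N.dest ∨ l ∉ Finset.Icc 1 N.L) → a i l = 0} := by
      simp only [Set.ofPred_forall]
      refine MeasurableSet.iInter fun i => MeasurableSet.iInter fun l =>
        MeasurableSet.iInter fun _ => ?_
      exact measurableSet_eq_fun
        ((measurable_pi_apply l).comp (measurable_pi_apply i)) measurable_const
    rw [ae_map_iff hf.aemeasurable hmeas]
    -- A zero rate has fractional part `0`, and `u < 0` fails on `[0, 1)`, so no packet arrives.
    filter_upwards [ae_restrict_mem measurableSet_Ico] with u hu i l hil
    simp [f, h.support i l hil, not_lt.2 hu.1]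
  · funext i l
    rw [meanRate, integral_map hf.aemeasurable (measurable_arrival i l).aestronglyMeasurable]
    exact hm i l

end LawExistence

/-! ### Random draws and independent sources of randomness -/

section Choices

instance (α : Type) : DiscreteMeasurableSpace (Choice α) := ⟨fun _ => trivial⟩

/-- A random choice with prescribed probabilities of the elements of a finite set. -/
lemma exists_choice_law {α : Type} (s : Finset α) (w : α → ℝ) (h0 : ∀ b, 0 ≤ w b)
    (h1 : ∑ b ∈ s, w b ≤ 1) (hs : ∀ b ∉ s, w b = 0) :
    ∃ μ : PMF (Choice α), ∀ b, μ (some b) = ENNReal.ofReal (w b) := by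
  let f : Option α → ENNReal := fun o =>
    o.elim (ENNReal.ofReal (1 - ∑ b ∈ s, w b)) fun b => ENNReal.ofReal (w b)
  refine ⟨PMF.ofFinset (α := Choice α) f (Finset.insertNone s) ?_ ?_, fun b => rfl⟩
  · refine (Finset.sum_insertNone f s).trans ?_
    simp only [f, Option.elim]
    rw [← ENNReal.ofReal_sum_of_nonneg fun b _ => h0 b,
      ← ENNReal.ofReal_add (by linarith) (Finset.sum_nonneg fun b _ => h0 b)]
    simp
  · rintro (_ | b) hb
    · exact absurd (Finset.none_mem_insertNone) hb
    · simp only [f, Option.elim]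
      rw [hs b fun h => hb (Finset.some_mem_insertNone.2 h), ENNReal.ofReal_zero]

end Choices

/-- An i.i.d. arrival process with law `ρ` together with independent draws with laws `ν k`. -/
structure RandomSource {E κ β : Type} [MeasurableSpace E] [MeasurableSpace β] (ρ : Measure E)
    (ν : κ → Measure β) where
  Ω : Type
  mΩ : MeasurableSpace Ω
  P : Measure Ω
  prob : IsProbabilityMeasure P
  a : ℕ → Ω → E
  D : κ → Ω → β
  measurable_a : ∀ t, Measurable (a t)
  measurable_D : ∀ k, Measurable (D k)
  law_a : ∀ t, P.map (a t) = ρ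
  law_D : ∀ k, P.map (D k) = ν k
  indep : iIndep (Sum.elim (fun t => MeasurableSpace.comap (a t) inferInstance)
    fun k => MeasurableSpace.comap (D k) inferInstance) P

attribute [instance] RandomSource.mΩ RandomSource.prob

namespace RandomSource

variable {E κ β : Type} [MeasurableSpace E] [MeasurableSpace β] {ρ : Measure E}
  {ν : κ → Measure β}

/-- An infinite product with all factors on the same space `E × β`; arrivals read the first
component and draws the second, the other one being a dummy. -/
lemma nonempty (ρ : Measure E) (ν : κ → Measure β) [IsProbabilityMeasure ρ]
    [∀ k, IsProbabilityMeasure (ν k)] [Inhabited β] : Nonempty (RandomSource ρ ν) := by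
  let μ : ℕ ⊕ κ → Measure (E × β) :=
    Sum.elim (fun _ => ρ.prod (Measure.dirac default)) fun k => ρ.prod (ν k)
  have hμ : ∀ i, IsProbabilityMeasure (μ i) := by
    rintro (t | k) <;> simp only [μ, Sum.elim_inl, Sum.elim_inr] <;> infer_instance
  have hind := iIndepFun_infinitePi (P := μ) (X := fun _ => id) fun _ => measurable_id
  rw [iIndepFun_iff_iIndep] at hind
  refine ⟨⟨ℕ ⊕ κ → E × β, inferInstance, Measure.infinitePi μ, inferInstance,
    fun t ω => (ω (Sum.inl t)).1, fun k ω => (ω (Sum.inr k)).2,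
    fun t => measurable_fst.comp (measurable_pi_apply _),
    fun k => measurable_snd.comp (measurable_pi_apply _), fun t => ?_, fun k => ?_, ?_⟩⟩
  · have := Measure.infinitePi_map_eval μ (Sum.inl t)
    change (Measure.infinitePi μ).map (Prod.fst ∘ fun x => x (Sum.inl t)) = ρ
    rw [← Measure.map_map measurable_fst (measurable_pi_apply _), this]
    simp [μ, Measure.map_fst_prod]
  · have := Measure.infinitePi_map_eval μ (Sum.inr k)
    change (Measure.infinitePi μ).map (Prod.snd ∘ fun x => x (Sum.inr k)) = ν k
    rw [← Measure.map_map measurable_snd (measurable_pi_apply _), this]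
    simp [μ, Measure.map_snd_prod]
  · refine iIndep_of_iIndep_of_le hind ?_
    rintro (t | k)
    · exact (measurable_fst.comp (comap_measurable _)).comap_le
    · exact (measurable_snd.comp (comap_measurable _)).comap_le

variable (S : RandomSource ρ ν)

/-- The information carried by one arrival or one draw. -/
abbrev sigma : ℕ ⊕ κ → MeasurableSpace S.Ω :=
  Sum.elim (fun t => MeasurableSpace.comap (S.a t) inferInstance)
    fun k => MeasurableSpace.comap (S.D k) inferInstance

lemma sigma_le (i : ℕ ⊕ κ) : S.sigma i ≤ S.mΩ := by
  rcases i with t | k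
  · exact (S.measurable_a t).comap_le
  · exact (S.measurable_D k).comap_le

/-- The information carried by a set of arrivals and draws. -/
abbrev info (s : Set (ℕ ⊕ κ)) : MeasurableSpace S.Ω := ⨆ i ∈ s, S.sigma i

lemma info_le (s : Set (ℕ ⊕ κ)) : S.info s ≤ S.mΩ := iSup₂_le fun i _ => S.sigma_le i

lemma info_mono {s s' : Set (ℕ ⊕ κ)} (h : s ⊆ s') : S.info s ≤ S.info s' := biSup_mono h

lemma measurable_info_a {s : Set (ℕ ⊕ κ)} {t : ℕ} (h : Sum.inl t ∈ s) :
    Measurable[S.info s] (S.a t) :=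
  (comap_measurable (S.a t)).mono (le_iSup₂_of_le (f := fun i _ => S.sigma i) _ h le_rfl) le_rfl

lemma measurable_info_D {s : Set (ℕ ⊕ κ)} {k : κ} (h : Sum.inr k ∈ s) :
    Measurable[S.info s] (S.D k) :=
  (comap_measurable (S.D k)).mono (le_iSup₂_of_le (f := fun i _ => S.sigma i) _ h le_rfl) le_rfl

lemma indep_info {s s' : Set (ℕ ⊕ κ)} (h : Disjoint s s') : Indep (S.info s) (S.info s') S.P :=
  indep_iSup_of_disjoint S.sigma_le S.indep h

lemma iIndepFun_D : iIndepFun S.D S.P := by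
  rw [iIndepFun_iff_iIndep]
  exact iIndep.precomp (g := Sum.inr) Sum.inr_injective S.indep

lemma indepFun_D_a : IndepFun (fun ω k => S.D k ω) (fun ω t => S.a t ω) S.P := by
  rw [IndepFun_iff_Indep]
  refine indep_of_indep_of_le_left (indep_of_indep_of_le_right
    (S.indep_info (s := Set.range Sum.inr) (s' := Set.range Sum.inl) ?_) ?_) ?_
  · exact Set.isCompl_range_inl_range_inr.symm.disjoint
  · refine Measurable.comap_le ?_
    exact @measurable_pi_lambda _ _ _ (S.info _) _ _ fun t => S.measurable_info_a ⟨t, rfl⟩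
  · refine Measurable.comap_le ?_
    exact @measurable_pi_lambda _ _ _ (S.info _) _ _ fun k => S.measurable_info_D ⟨k, rfl⟩

/-- The arrivals before slot `t` and all draws. -/
def past (κ : Type) (t : ℕ) : Set (ℕ ⊕ κ) := Sum.inl '' Set.Iio t ∪ Set.range Sum.inr

/-- Ensures that, outside one null set, no draw ever selects an option to which the flow `x` assigns
zero, in particular a non-link. -/
lemma ae_D_ne_zero [Countable κ] {β : Type} {α : κ → PMF (Choice β)}
    (S : RandomSource ρ fun k => (α k).toMeasure) :
    ∀ᵐ ω ∂S.P, ∀ k, α k (S.D k ω) ≠ 0 := by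
  refine ae_all_iff.2 fun k => ?_
  refine ae_of_ae_map (p := fun c => α k c ≠ 0) (S.measurable_D k).aemeasurable ?_
  rw [S.law_D k, ae_iff, PMF.toMeasure_apply_eq_zero_iff _ (MeasurableSet.of_discrete)]
  rw [Set.disjoint_left]
  intro c hc hc'
  exact hc' ((PMF.mem_support_iff _ _).1 hc)

lemma measureReal_D_eq {β : Type} {α : κ → PMF (Choice β)}
    (S : RandomSource ρ fun k => (α k).toMeasure) {k : κ} {c : Choice β} {r : ℝ} (hr : 0 ≤ r)
    (h : α k c = ENNReal.ofReal r) : S.P.real {ω | S.D k ω = c} = r := by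
  have h1 : S.P {ω | S.D k ω = c} = (S.P.map (S.D k)) {c} :=
    (Measure.map_apply (S.measurable_D k) (measurableSet_singleton c)).symm
  rw [Measure.real, h1, S.law_D k, PMF.toMeasure_apply_singleton _ _ (measurableSet_singleton c), h,
    ENNReal.toReal_ofReal hr]

section ToPolicy

variable {V : Type} [Fintype V] {N : Network V} {ρ : Measure (Arrivals V)}

/-- The policy that takes decisions `x` on the basis of the draws and the past arrivals. -/
def toPolicy (S : RandomSource ρ ν) (x : ℕ → S.Ω → Flow V)
    (hx : ∀ t, Measurable[S.info (past κ t)] (x t))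
    (hflow : ∀ᵐ ω ∂S.P, ∀ t, IsFlow N (x t ω)) : Policy N ρ where
  Ω := S.Ω
  mΩ := S.mΩ
  P := S.P
  prob := S.prob
  -- Draws of future slots may belong to the present information: the filtration need only be
  -- independent of the current arrivals.
  ℱ :=
    { seq := fun t => S.info (past κ t)
      mono' := fun s t hst => S.info_mono
        (Set.union_subset_union_left _ (Set.image_mono (Set.Iio_subset_Iio hst)))
      le' := fun t => S.info_le _ }
  a := S.a
  x := x
  a_adapted t := S.measurable_info_a (Or.inl ⟨t, Nat.lt_succ_self t, rfl⟩)
  a_law := S.law_a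
  a_indep t := by
    refine indep_of_indep_of_le_right (S.indep_info (s' := {Sum.inl t}) ?_) ?_
    · simp [past]
    · exact (S.measurable_info_a (Set.mem_singleton _)).comap_le
  x_adapted := hx
  x_isFlow := hflow

end ToPolicy

end RandomSource

/-! ### Stationary policies for the virtual network -/

section Sufficiency

variable {V : Type} [Fintype V] {N : Network V} {ρ : Measure (Arrivals V)} {γ : ℝ}
  {p : Policy N ρ} {B : ℝ} {x : Flow V}

lemma Policy.BoundedBy.reliable_of_eventually (hp : p.BoundedBy B)
    (hx : ∀ᶠ t in atTop, p.meanFlow t = x) (h : FlowConditions N (meanRate ρ) γ x) :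
    p.Reliable γ :=
  ⟨_, hp.hasTimeAvg_of_eventually hx (delivered_mem_flowFunctionals N), h.reliability⟩

lemma FlowConditions.exists_choice_law_link {lam : Rates V} (h : FlowConditions N lam γ x)
    (i j : V) : ∃ μ : PMF (Choice ℕ), ∀ l, μ (some l) = ENNReal.ofReal (x i j l / N.cap i j) := by
  have hx := h.isFlow
  refine exists_choice_law (Finset.Icc 1 N.L) _
    (fun l => div_nonneg (hx.nonneg i j l) (N.cap i j).2) ?_ fun l hl => ?_
  · rw [← Finset.sum_div]
    refine div_le_one_of_le₀ ?_ (N.cap i j).2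
    by_cases hij : N.graph.Adj i j
    · exact h.capacity i j hij
    · rw [Finset.sum_eq_zero fun l _ => hx.support i j l fun h => hij h.1]
      exact (N.cap i j).2
  · rw [hx.support i j l fun h => hl h.2, zero_div]

/-- Where the capacity is zero the flow vanishes as well, so the convention `x / 0 = 0` does no
harm. -/
lemma FlowConditions.cap_mul_div {lam : Rates V} (h : FlowConditions N lam γ x) (i j : V) (l : ℕ) :
    (N.cap i j : ℝ) * (x i j l / N.cap i j) = x i j l := by
  by_cases h0 : (N.cap i j : ℝ) = 0
  · by_cases hl : N.graph.Adj i j ∧ l ∈ Finset.Icc 1 N.L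
    · have h1 := (h.isFlow.le_linkFlow i j hl.2).trans (h.capacity i j hl.1)
      rw [h0] at h1
      simp [le_antisymm h1 (h.isFlow.nonneg i j l)]
    · simp [h.isFlow.support i j l hl]
  · field_simp

/-- The links of the virtual network can be shared according to any admissible flow. -/
lemma FlowConditions.exists_policy₂ (hρ : IsArrivalLaw N ρ)
    (h : FlowConditions N (meanRate ρ) γ x) :
    ∃ p : Policy N ρ, p.Feasible₂ γ ∧ p.StationaryRandomized₂ ∧ p.HasCost (flowCost N x) := by
  classical
  have := hρ.prob
  choose α hα using h.exists_choice_law_link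
  have : Inhabited (Choice ℕ) := ⟨(none : Option ℕ)⟩
  obtain ⟨S⟩ := RandomSource.nonempty ρ
    fun k : ℕ × V × V => (α k.2.1 k.2.2).toMeasure
  let X : ℕ → S.Ω → Flow V := fun t ω i j l =>
    if S.D (t, i, j) ω = some l then (N.cap i j : ℝ) else 0
  have hsome : ∀ᵐ ω ∂S.P, ∀ t i j l, S.D (t, i, j) ω = some l → x i j l ≠ 0 := by
    have h1 := RandomSource.ae_D_ne_zero (α := fun k : ℕ × V × V => α k.2.1 k.2.2) S
    filter_upwards [h1] with ω hω t i j l hD h0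
    refine hω (t, i, j) ?_
    change α i j (S.D (t, i, j) ω) = 0
    rw [hD, hα, h0, zero_div, ENNReal.ofReal_zero]
  have hflow : ∀ᵐ ω ∂S.P, ∀ t, IsFlow N (X t ω) := by
    filter_upwards [hsome] with ω hω t
    refine ⟨fun i j l => ?_, fun i j l hl => if_neg fun hD =>
      hω t i j l hD (h.isFlow.support i j l hl)⟩
    simp only [X]
    split_ifs
    exacts [(N.cap i j).2, le_rfl]
  have hmeas : ∀ t, Measurable[S.info (RandomSource.past _ t)] (X t) := by
    intro t
    refine @measurable_pi_lambda _ _ _ (S.info _) _ _ fun i => @measurable_pi_lambda _ _ _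
      (S.info _) _ _ fun j => @measurable_pi_lambda _ _ _ (S.info _) _ _ fun l => ?_
    have hD : Measurable[S.info (RandomSource.past _ t)] (S.D (t, i, j)) :=
      S.measurable_info_D (Or.inr ⟨_, rfl⟩)
    exact (measurable_from_top (f := fun c : Choice ℕ =>
      if c = some l then (N.cap i j : ℝ) else 0)).comp hD
  let p : Policy N ρ := S.toPolicy X hmeas hflow
  -- At most one lifetime is drawn per link, so at most one summand is nonzero.
  have hcap : ∀ᵐ ω ∂p.P, ∀ t i j, linkFlow N (p.x t ω) i j ≤ N.cap i j := by
    refine Eventually.of_forall fun ω t i j => ?_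
    change ∑ l ∈ Finset.Icc 1 N.L, (if S.D (t, i, j) ω = some l then (N.cap i j : ℝ) else 0) ≤ _
    rcases hD : S.D (t, i, j) ω with _ | m
    · refine le_of_eq_of_le (Finset.sum_eq_zero fun l _ => if_neg ?_) (N.cap i j).2
      exact (Option.some_ne_none l).symm
    · have hm : ∀ l, (if (some m : Option ℕ) = some l then (N.cap i j : ℝ) else 0) =
          if m = l then (N.cap i j : ℝ) else 0 := fun l => by simp only [Option.some.injEq]
      refine le_of_eq_of_le (Finset.sum_congr rfl fun l _ => ?_) (le_of_eq_of_le
        (Finset.sum_ite_eq (Finset.Icc 1 N.L) m fun _ => (N.cap i j : ℝ)) ?_)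
      · convert hm l
        exact Iff.rfl
      · split_ifs
        exacts [le_rfl, (N.cap i j).2]
  have hB : p.BoundedBy (∑ i, ∑ j, (N.cap i j : ℝ)) := by
    refine Eventually.of_forall fun ω t i j l => ?_
    have h1 : X t ω i j l ≤ N.cap i j := by
      simp only [X]
      split_ifs
      exacts [le_rfl, (N.cap i j).2]
    exact h1.trans (cap_le_sum_cap N i j)
  have hmean : ∀ t, p.meanFlow t = x := by
    intro t
    funext i j l
    have hlaw : S.P.real {ω | S.D (t, i, j) ω = (some l : Option ℕ)} = x i j l / N.cap i j :=
      RandomSource.measureReal_D_eq (α := fun k : ℕ × V × V => α k.2.1 k.2.2) S (k := (t, i, j))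
        (c := (some l : Option ℕ)) (div_nonneg (h.isFlow.nonneg i j l) (N.cap i j).2) (hα i j l)
    rw [← h.cap_mul_div i j l, ← hlaw]
    have hset : MeasurableSet {ω | S.D (t, i, j) ω = (some l : Option ℕ)} :=
      S.measurable_D _ (measurableSet_singleton (α := Choice ℕ) (some l))
    have h1 : ∀ ω, X t ω i j l =
        {ω | S.D (t, i, j) ω = (some l : Option ℕ)}.indicator (fun _ => (N.cap i j : ℝ)) ω := by
      intro ω
      simp [X, Set.indicator_apply]
    change ∫ ω, X t ω i j l ∂S.P = _
    simp only [h1]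
    rw [integral_indicator_const _ hset, smul_eq_mul, mul_comm]
  have hev : ∀ᶠ t in atTop, p.meanFlow t = x := Eventually.of_forall hmean
  refine ⟨p, ⟨hB.reliable_of_eventually hev h, ?_, fun i l hl => ⟨_, _,
    hB.hasTimeAvg_of_eventually hev (outflowGe_mem_flowFunctionals N i l),
    hB.hasTimeAvg_of_eventually hev (inflowGe_mem_flowFunctionals N i (l + 1)),
    h.conservation i l hl⟩, ?_⟩,
    ⟨α, S.D, S.measurable_D, S.iIndepFun_D, fun t i j => S.law_D _, S.indepFun_D_a,
      fun t ω i j l => ⟨fun hD => if_pos hD, fun hD => if_neg hD⟩⟩,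
    hB.hasTimeAvg_of_eventually hev (flowCost_mem_flowFunctionals N)⟩
  · filter_upwards [hcap] with ω hω t i j _ using hω t i j
  · filter_upwards [hsome] with ω hω t k hk l hl
    exact if_neg fun hD => hω t N.dest k l hD (h.dest_silent k hk l hl)

end Sufficiency

/-! ### Packet-by-packet dynamics -/

section PacketDynamics

lemma measurable_sum_range_nat {Ω : Type*} {m : MeasurableSpace Ω} {q : Ω → ℕ}
    {f : ℕ → Ω → ℕ} (hq : Measurable q) (hf : ∀ n, Measurable (f n)) :
    Measurable fun ω => ∑ n ∈ Finset.range (q ω), f n ω := by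
  have h : Measurable fun z : ℕ × Ω => ∑ n ∈ Finset.range z.1, f n z.2 :=
    measurable_from_prod_countable_right fun k =>
      Finset.measurable_fun_sum (Finset.range k) fun n _ => hf n
  exact h.comp (hq.prodMk measurable_id)

variable {V : Type}

open Classical in
/-- The number of lifetime-`l` packets at node `i` that draw the neighbor `j` in slot `t`. -/
def sent (D : ℕ × V × ℕ × ℕ → Choice V) (t : ℕ) (q : V → ℕ → ℕ) (i j : V) (l : ℕ) : ℕ :=
  ∑ n ∈ Finset.range (q i l), if D (t, i, l, n) = (some j : Option V) then 1 else 0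

open Classical in
lemma sent_eq_ncard (D : ℕ × V × ℕ × ℕ → Choice V) (t : ℕ) (q : V → ℕ → ℕ) (i j : V)
    (l : ℕ) : sent D t q i j l =
      {n : ℕ | n < q i l ∧ D (t, i, l, n) = (some j : Option V)}.ncard := by
  rw [sent, Finset.sum_boole, Nat.cast_id, ← Set.ncard_coe_finset]
  congr 1
  ext n
  simp

open Classical in
lemma measurable_sent {Ω : Type} {m : MeasurableSpace Ω}
    {D : ℕ × V × ℕ × ℕ → Ω → Choice V} {t : ℕ} {q : Ω → V → ℕ → ℕ} {i : V} {l : ℕ}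
    (hq : Measurable fun ω => q ω i l) (hD : ∀ n, Measurable (D (t, i, l, n))) (j : V) :
    Measurable fun ω => sent (fun k => D k ω) t (q ω) i j l :=
  measurable_sum_range_nat hq fun n =>
    (measurable_from_top (f := fun c : Choice V =>
      if c = (some j : Option V) then 1 else 0)).comp (hD n)

variable [Fintype V]

/-- Each packet draws at most one neighbor. This gives availability and keeps the natural-number
subtraction in `packetQueue` from truncating. -/
lemma sum_sent_le (D : ℕ × V × ℕ × ℕ → Choice V) (t : ℕ) (q : V → ℕ → ℕ) (i : V) (l : ℕ) :
    ∑ j, sent D t q i j l ≤ q i l := by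
  simp only [sent]
  rw [Finset.sum_comm]
  refine (Finset.sum_le_card_nsmul _ _ 1 fun n _ => ?_).trans (by simp)
  rcases h : D (t, i, l, n) with _ | k
  · refine le_of_eq_of_le (Finset.sum_eq_zero fun j _ => if_neg ?_) zero_le_one
    exact (Option.some_ne_none j).symm
  · refine le_of_eq ?_
    rw [Finset.sum_eq_single k]
    · exact if_pos rfl
    · intro j _ hj
      exact if_neg fun h => hj (Option.some.inj h).symm
    · simp

variable [DecidableEq V]

/-- The numbers of queued packets when every packet follows its draw. -/
def packetQueue (N : Network V) (a : ℕ → Arrivals V) (D : ℕ × V × ℕ × ℕ → Choice V) :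
    ℕ → V → ℕ → ℕ
  | 0 => fun _ _ => 0
  | t + 1 => fun i l =>
      if i = N.dest ∨ l ∉ Finset.Icc 1 N.L then 0
      else packetQueue N a D t i (l + 1)
        - ∑ j, sent D t (packetQueue N a D t) i j (l + 1)
        + ∑ j, sent D t (packetQueue N a D t) j i (l + 1) + a t i l

variable {N : Network V} {a : ℕ → Arrivals V} {D : ℕ × V × ℕ × ℕ → Choice V}

/-- The flows of the packets. -/
def packetFlow (N : Network V) (a : ℕ → Arrivals V) (D : ℕ × V × ℕ × ℕ → Choice V) (t : ℕ) :
    Flow V := fun i j l => (sent D t (packetQueue N a D t) i j l : ℝ)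

lemma queue_packetFlow (t : ℕ) (i : V) (l : ℕ) :
    queue N a (packetFlow N a D) t i l = packetQueue N a D t i l := by
  induction t generalizing i l with
  | zero => simp [queue, packetQueue]
  | succ t ih =>
    simp only [queue, packetQueue]
    split_ifs
    · simp
    · rw [ih]
      push_cast [sum_sent_le D t (packetQueue N a D t) i (l + 1)]
      simp only [outflow, inflow, packetFlow]

lemma outflow_packetFlow_le (t : ℕ) (i : V) (l : ℕ) :
    outflow (packetFlow N a D t) i l ≤ queue N a (packetFlow N a D) t i l := by
  rw [queue_packetFlow, outflow]
  simp only [packetFlow]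
  exact_mod_cast sum_sent_le D t _ i l

section Measurability

variable {Ω : Type} {m : MeasurableSpace Ω} {a : ℕ → Ω → Arrivals V}
  {D : ℕ × V × ℕ × ℕ → Ω → Choice V}

/-- Only arrivals and draws of earlier slots enter; this makes the backlog independent of the draws
of slot `t`. -/
lemma measurable_packetQueue (t : ℕ) (ha : ∀ s < t, Measurable (a s))
    (hD : ∀ s < t, ∀ k, Measurable (D (s, k))) (i : V) (l : ℕ) :
    Measurable fun ω => packetQueue N (fun s => a s ω) (fun k => D k ω) t i l := by
  induction t generalizing i l with
  | zero => exact measurable_const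
  | succ t ih =>
    have hq := ih (fun s hs => ha s (hs.trans t.lt_succ_self))
      fun s hs => hD s (hs.trans t.lt_succ_self)
    have hs : ∀ i j l, Measurable fun ω => sent (fun k => D k ω) t
        (packetQueue N (fun s => a s ω) (fun k => D k ω) t) i j l := fun i j l =>
      measurable_sent (hq i l) (fun n => hD t t.lt_succ_self _) j
    have hat : Measurable fun ω => a t ω i l :=
      (measurable_pi_apply l).comp ((measurable_pi_apply i).comp (ha t t.lt_succ_self))
    by_cases h : i = N.dest ∨ l ∉ Finset.Icc 1 N.L
    · simp only [packetQueue, if_pos h]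
      exact measurable_const
    · simp only [packetQueue, if_neg h]
      exact (((hq i (l + 1)).sub (Finset.measurable_fun_sum _ fun j _ => hs i j (l + 1))).add
        (Finset.measurable_fun_sum _ fun j _ => hs j i (l + 1))).add hat

end Measurability

end PacketDynamics

/-! ### Expected number of packets sent -/

section Expectation

lemma natCast_eq_sum_boole {q M : ℕ} (h : q ≤ M) :
    (q : ℝ) = ∑ n ∈ Finset.range M, if n < q then (1 : ℝ) else 0 := by
  rw [Finset.sum_boole]
  congr 1
  rw [show (Finset.range M).filter (· < q) = Finset.range q by ext n; simp; omega]
  simp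

/-- Wald's identity for a bounded number of independent marks. -/
lemma integral_sum_range_marks {Ω : Type*} {mΩ : MeasurableSpace Ω} {P : Measure Ω}
    [IsProbabilityMeasure P] {q : Ω → ℕ} {s : ℕ → Set Ω} {M : ℕ} {r : ℝ} (hq : Measurable q)
    (hs : ∀ n, MeasurableSet (s n)) (hM : ∀ᵐ ω ∂P, q ω ≤ M) (hr : ∀ n, P.real (s n) = r)
    (hind : ∀ n, P.real ({ω | n < q ω} ∩ s n) = P.real {ω | n < q ω} * P.real (s n))
    {f : Ω → ℝ} (hf : ∀ ω, f ω = ∑ n ∈ Finset.range (q ω), (s n).indicator 1 ω) :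
    ∫ ω, f ω ∂P = r * ∫ ω, (q ω : ℝ) ∂P := by
  have hqs : ∀ n, MeasurableSet {ω | n < q ω} := fun n => measurableSet_lt measurable_const hq
  -- The deterministic bound `M` replaces the random range by a fixed sum over the events `n < q`,
  -- each independent of the mark `s n`.
  have h1 : ∀ᵐ ω ∂P, f ω =
      ∑ n ∈ Finset.range M, ({ω | n < q ω} ∩ s n).indicator (1 : Ω → ℝ) ω := by
    filter_upwards [hM] with ω hω
    rw [hf, ← Finset.sum_subset (Finset.range_subset_range.2 hω)]
    · refine Finset.sum_congr rfl fun n hn => ?_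
      have : n < q ω := Finset.mem_range.1 hn
      by_cases hω' : ω ∈ s n
      · rw [Set.indicator_of_mem hω',
          Set.indicator_of_mem (show ω ∈ {ω | n < q ω} ∩ s n from ⟨this, hω'⟩)]
      · rw [Set.indicator_of_notMem hω', Set.indicator_of_notMem fun h => hω' h.2]
    · intro n _ hn
      have : ω ∉ {ω | n < q ω} ∩ s n := fun h => hn (Finset.mem_range.2 h.1)
      exact Set.indicator_of_notMem this _
  have h2 : ∀ᵐ ω ∂P, (q ω : ℝ) =
      ∑ n ∈ Finset.range M, {ω | n < q ω}.indicator (1 : Ω → ℝ) ω := by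
    filter_upwards [hM] with ω hω
    rw [natCast_eq_sum_boole hω]
    simp [Set.indicator_apply]
  have hint : ∀ u : Set Ω, MeasurableSet u → Integrable (u.indicator (1 : Ω → ℝ)) P :=
    fun u hu => (integrable_const (1 : ℝ)).indicator hu
  rw [integral_congr_ae h1, integral_congr_ae h2,
    integral_finsetSum _ fun n _ => hint _ ((hqs n).inter (hs n)),
    integral_finsetSum _ fun n _ => hint _ (hqs n), Finset.mul_sum]
  refine Finset.sum_congr rfl fun n _ => ?_
  rw [integral_indicator_one ((hqs n).inter (hs n)), integral_indicator_one (hqs n), hind, hr,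
    mul_comm]

end Expectation

/-! ### Stationary policies for the actual network -/

section PacketPolicy

variable {V : Type} [Fintype V] {N : Network V} {ρ : Measure (Arrivals V)} {γ : ℝ}
  {x : Flow V}

lemma FlowConditions.outflow_le {lam : Rates V} (h : FlowConditions N lam γ x) (i : V) {l : ℕ}
    (hl : l ∈ Finset.Icc 1 N.L) : outflow x i l ≤ stationaryBacklog N lam x i l := by
  have := h.conservation i l hl
  rw [h.isFlow.outflowGe_eq_add] at this
  rw [stationaryBacklog]
  linarith

/-- Conservation says that outflow is at most the stationary backlog, so the forwarding fractions
sum to at most one. Outside `1, …, L` the backlog may have any sign, but the flow is zero there. -/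
lemma FlowConditions.exists_choice_law_packet {lam : Rates V} (h : FlowConditions N lam γ x)
    (i : V) (l : ℕ) : ∃ μ : PMF (Choice V), ∀ j, μ (some j) =
      ENNReal.ofReal (x i j l / stationaryBacklog N lam x i l) ∧
      0 ≤ x i j l / stationaryBacklog N lam x i l := by
  have hx := h.isFlow
  by_cases hl : l ∈ Finset.Icc 1 N.L
  · have h0 : 0 ≤ stationaryBacklog N lam x i l :=
      (hx.outflow_nonneg i l).trans (h.outflow_le i hl)
    have hw : ∀ j, 0 ≤ x i j l / stationaryBacklog N lam x i l :=
      fun j => div_nonneg (hx.nonneg i j l) h0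
    obtain ⟨μ, hμ⟩ := exists_choice_law Finset.univ _ hw
      (by rw [← Finset.sum_div]; exact div_le_one_of_le₀ (h.outflow_le i hl) h0) (by simp)
    exact ⟨μ, fun j => ⟨hμ j, hw j⟩⟩
  · obtain ⟨μ, hμ⟩ := exists_choice_law (Finset.univ : Finset V) (fun _ => 0) (fun _ => le_rfl)
      (by simp) (by simp)
    refine ⟨μ, fun j => ?_⟩
    rw [hx.support i j l fun h => hl h.2, zero_div]
    exact ⟨hμ j, le_rfl⟩

lemma FlowConditions.div_mul_stationaryBacklog {lam : Rates V} (h : FlowConditions N lam γ x)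
    (i j : V) (l : ℕ) :
    x i j l / stationaryBacklog N lam x i l * stationaryBacklog N lam x i l = x i j l := by
  by_cases h0 : stationaryBacklog N lam x i l = 0
  · by_cases hl : l ∈ Finset.Icc 1 N.L
    · have h1 := (h.isFlow.le_outflow i j l).trans (h.outflow_le i hl)
      rw [h0] at h1
      simp [le_antisymm h1 (h.isFlow.nonneg i j l)]
    · simp [h.isFlow.support i j l fun h => hl h.2]
  · exact div_mul_cancel₀ _ h0

variable [DecidableEq V]

/-- If the mean flows are the right fractions of the mean backlogs, both are stationary after `L`
slots. -/
lemma Policy.Available.meanBacklog_eq {p : Policy N ρ} (hp : p.Available) (hρ : IsArrivalLaw N ρ)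
    (h : FlowConditions N (meanRate ρ) γ x)
    (hflow : ∀ t i j l, p.meanFlow t i j l =
      x i j l / stationaryBacklog N (meanRate ρ) x i l * p.meanBacklog t i l) (k : ℕ) :
    ∀ l t i, i ≠ N.dest → 1 ≤ l → l + k = N.L + 1 → k ≤ t →
      p.meanBacklog t i l = stationaryBacklog N (meanRate ρ) x i l := by
  induction k with
  | zero =>
    intro l t i _ _ hl _
    rw [stationaryBacklog_of_gt _ _ _ (by omega),
      Policy.meanBacklog_of_or t (Or.inr (by simp; omega))]
  | succ k ih =>
    intro l t i hi hl1 hl ht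
    obtain ⟨t, rfl⟩ : ∃ s, t = s + 1 := ⟨t - 1, by omega⟩
    have hb : ∀ i ≠ N.dest, p.meanBacklog t i (l + 1) =
        stationaryBacklog N (meanRate ρ) x i (l + 1) :=
      fun i hi => ih (l + 1) t i hi (by omega) (by omega) (by omega)
    -- The destination must be treated apart: its actual backlog is zero, whatever
    -- `stationaryBacklog` is, and agreement comes from its silence in `x`.
    have hf : ∀ i j, p.meanFlow t i j (l + 1) = x i j (l + 1) := by
      intro i j
      rw [hflow]
      by_cases hi : i = N.dest
      · have : x i j (l + 1) = 0 := by
          subst hi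
          by_cases hj : N.graph.Adj N.dest j ∧ l + 1 ∈ Finset.Icc 1 N.L
          · exact h.dest_silent j hj.1 _ hj.2
          · exact h.isFlow.support _ _ _ hj
        simp [this]
      · rw [hb i hi, h.div_mul_stationaryBacklog]
    rw [hp.meanBacklog_succ hρ t (by
      simp only [not_or, not_not, Finset.mem_Icc]; exact ⟨hi, hl1, by omega⟩),
      h.isFlow.stationaryBacklog_eq _ _ (by omega), hb i hi]
    simp only [outflow, inflow, hf]

/-- Packets can be forwarded at random according to any admissible flow. -/
lemma FlowConditions.exists_policy₁ (hρ : IsArrivalLaw N ρ)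
    (h : FlowConditions N (meanRate ρ) γ x) :
    ∃ p : Policy N ρ, p.Feasible₁ γ ∧ p.StationaryRandomized₁ ∧ p.HasCost (flowCost N x) := by
  have := hρ.prob
  choose α hα using h.exists_choice_law_packet
  have : Inhabited (Choice V) := ⟨(none : Option V)⟩
  obtain ⟨S⟩ := RandomSource.nonempty ρ
    fun k : ℕ × V × ℕ × ℕ => (α k.2.1 k.2.2.1).toMeasure
  let X : ℕ → S.Ω → Flow V := fun t ω =>
    packetFlow N (fun s => S.a s ω) (fun k => S.D k ω) t
  have hsome : ∀ᵐ ω ∂S.P, ∀ t i l n j, S.D (t, i, l, n) ω = (some j : Option V) →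
      x i j l ≠ 0 := by
    have h1 := RandomSource.ae_D_ne_zero (α := fun k : ℕ × V × ℕ × ℕ => α k.2.1 k.2.2.1) S
    filter_upwards [h1] with ω hω t i l n j hD h0
    refine hω (t, i, l, n) ?_
    change α i l (S.D (t, i, l, n) ω) = 0
    rw [hD, (hα i l j).1, h0, zero_div, ENNReal.ofReal_zero]
  have hflow : ∀ᵐ ω ∂S.P, ∀ t, IsFlow N (X t ω) := by
    filter_upwards [hsome] with ω hω t
    refine ⟨fun i j l => Nat.cast_nonneg _, fun i j l hl => ?_⟩
    refine Nat.cast_eq_zero.2 (Finset.sum_eq_zero fun n _ => if_neg fun hD => ?_)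
    exact hω t i l n j hD (h.isFlow.support i j l hl)
  have hmeas : ∀ t, Measurable[S.info (RandomSource.past _ t)] (X t) := by
    intro t
    refine @measurable_pi_lambda _ _ _ (S.info _) _ _ fun i => @measurable_pi_lambda _ _ _
      (S.info _) _ _ fun j => @measurable_pi_lambda _ _ _ (S.info _) _ _ fun l => ?_
    have hD : ∀ k, Measurable[S.info (RandomSource.past _ t)] (S.D k) :=
      fun k => S.measurable_info_D (Or.inr ⟨k, rfl⟩)
    have ha : ∀ s < t, Measurable[S.info (RandomSource.past _ t)] (S.a s) :=
      fun s hs => S.measurable_info_a (Or.inl ⟨s, hs, rfl⟩)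
    refine (measurable_from_top (f := fun n : ℕ => (n : ℝ))).comp ?_
    exact measurable_sent (m := S.info _) (measurable_packetQueue t ha (fun s _ k => hD _) i l)
      (fun n => hD _) j
  let p : Policy N ρ := S.toPolicy X hmeas hflow
  have hback : ∀ t i l ω, p.backlog t i l ω =
      packetQueue N (fun s => S.a s ω) (fun k => S.D k ω) t i l :=
    fun t i l ω => queue_packetFlow t i l
  have hav : p.Available := Eventually.of_forall fun ω t i l _ => outflow_packetFlow_le t i l
  obtain ⟨B, -, hB⟩ := hav.exists_boundedBy hρ
  obtain ⟨B', -, hB'⟩ := hav.exists_bound hρ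
  have hmean : ∀ t i j l, p.meanFlow t i j l =
      x i j l / stationaryBacklog N (meanRate ρ) x i l * p.meanBacklog t i l := by
    intro t i j l
    let q : S.Ω → ℕ := fun ω => packetQueue N (fun s => S.a s ω) (fun k => S.D k ω) t i l
    -- The policy's filtration contains all draws, so independence needs this smaller information,
    -- which excludes the draws of slot `t`.
    let before : Set (ℕ ⊕ (ℕ × V × ℕ × ℕ)) :=
      Sum.inl '' Set.Iio t ∪ Sum.inr '' {k | k.1 < t}
    have hq : Measurable[S.info before] q :=
      measurable_packetQueue (m := S.info before) t
        (fun s hs => S.measurable_info_a (Or.inl ⟨s, hs, rfl⟩))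
        (fun s hs k => S.measurable_info_D (Or.inr ⟨(s, k), hs, rfl⟩)) i l
    have hs : ∀ n, MeasurableSet {ω | S.D (t, i, l, n) ω = (some j : Option V)} := fun n =>
      S.measurable_D _ (measurableSet_singleton (α := Choice V) (some j))
    have hback' : p.meanBacklog t i l = ∫ ω, (q ω : ℝ) ∂S.P :=
      integral_congr_ae (Eventually.of_forall fun ω => hback t i l ω)
    rw [hback']
    refine integral_sum_range_marks (P := S.P) (q := q)
      (s := fun n => {ω | S.D (t, i, l, n) ω = (some j : Option V)})
      (M := ⌊B'⌋₊) (hq.mono (S.info_le _) le_rfl) hs ?_ (fun n => ?_) (fun n => ?_) fun ω => ?_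
    · filter_upwards [hB'] with ω hω
      exact Nat.le_floor ((hback t i l ω).symm.trans_le (hω t i l).2)
    · exact RandomSource.measureReal_D_eq (α := fun k : ℕ × V × ℕ × ℕ => α k.2.1 k.2.2.1) S
        (k := (t, i, l, n)) (c := (some j : Option V)) (hα i l j).2 (hα i l j).1
    · have hind : Indep (S.info before) (S.info {Sum.inr (t, i, l, n)}) S.P :=
        S.indep_info (by simp [before])
      have h1 := (Indep_iff _ _ _).1 hind {ω | n < q ω}
        {ω | S.D (t, i, l, n) ω = (some j : Option V)}
        (hq measurableSet_Ioi)
        (S.measurable_info_D (Set.mem_singleton _)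
          (measurableSet_singleton (α := Choice V) (some j)))
      simp only [Measure.real, h1, ENNReal.toReal_mul]
    · change ((sent _ _ _ _ _ _ : ℕ) : ℝ) = _
      rw [sent]
      push_cast
      refine Finset.sum_congr rfl fun n _ => ?_
      by_cases hD : S.D (t, i, l, n) ω = (some j : Option V)
      · rw [if_pos hD]
        exact (Set.indicator_of_mem (M := ℝ)
          (s := {ω | S.D (t, i, l, n) ω = (some j : Option V)}) hD 1).symm
      · rw [if_neg hD]
        exact (Set.indicator_of_notMem (M := ℝ)
          (s := {ω | S.D (t, i, l, n) ω = (some j : Option V)}) hD 1).symm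
  have hev : ∀ᶠ t in atTop, p.meanFlow t = x := by
    -- Lifetime `l` is stationary from slot `L + 1 - l` on, so `L + 1` slots suffice for all
    -- lifetimes.
    filter_upwards [eventually_ge_atTop (N.L + 1)] with t ht
    funext i j l
    by_cases hl : l ∈ Finset.Icc 1 N.L
    · have hl' := Finset.mem_Icc.1 hl
      rw [hmean]
      by_cases hi : i = N.dest
      · have : x i j l = 0 := by
          subst hi
          by_cases hj : N.graph.Adj N.dest j
          · exact h.dest_silent j hj _ hl
          · exact h.isFlow.support _ _ _ fun hj' => hj hj'.1
        simp [this]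
      · rw [hav.meanBacklog_eq hρ h hmean (N.L + 1 - l) l t i hi hl'.1 (by omega) (by omega),
          h.div_mul_stationaryBacklog]
    · rw [h.isFlow.support i j l fun h => hl h.2,
        (p.isFlow_meanFlow t).support i j l fun h => hl h.2]
  refine ⟨p, ⟨hB.reliable_of_eventually hev h, fun i j hij => ⟨_,
    hB.hasTimeAvg_of_eventually hev (linkFlow_mem_flowFunctionals N i j), h.capacity i j hij⟩,
    hav⟩, ⟨α, S.D, S.measurable_D, S.iIndepFun_D, fun t i l n => S.law_D _, S.indepFun_D_a,
      fun t ω i j l => ?_⟩,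
    hB.hasTimeAvg_of_eventually hev (flowCost_mem_flowFunctionals N)⟩
  rw [hback, Nat.floor_natCast]
  exact congrArg Nat.cast (sent_eq_ncard _ t _ i j l)

end PacketPolicy

end DelayNet

end

/-! ### The theorem -/

open DelayNet in
theorem theorem1 {V : Type} [Fintype V] [DecidableEq V] (N : Network V) :
    -- the two stability regions coincide
    stabilityRegion₁ N = stabilityRegion₂ N ∧
    -- for every arrival law, feasibility depends on the mean rates only
    (∀ ρ, IsArrivalLaw N ρ → ∀ γ : ℝ,
      ((feasiblePolicies₁ N ρ γ).Nonempty ↔ (meanRate ρ, γ) ∈ stabilityRegion₁ N) ∧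
      ((feasiblePolicies₂ N ρ γ).Nonempty ↔ (meanRate ρ, γ) ∈ stabilityRegion₂ N)) ∧
    -- characterization by lifetime-indexed flows
    (∀ lam, IsRate N lam → ∀ γ : ℝ,
      ((lam, γ) ∈ stabilityRegion₁ N ↔ ∃ x, FlowConditions N lam γ x) ∧
      ((lam, γ) ∈ stabilityRegion₂ N ↔ ∃ x, FlowConditions N lam γ x)) ∧
    -- feasible stationary randomized policies attain the optimal costs
    (∀ ρ, IsArrivalLaw N ρ → ∀ γ : ℝ,
      ((meanRate ρ, γ) ∈ stabilityRegion₁ N →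
        ∃ p ∈ feasiblePolicies₁ N ρ γ, p.StationaryRandomized₁ ∧
          ∃ c, p.HasCost c ∧ IsLeast (costs₁ N ρ γ) c) ∧
      ((meanRate ρ, γ) ∈ stabilityRegion₂ N →
        ∃ p ∈ feasiblePolicies₂ N ρ γ, p.StationaryRandomized₂ ∧
          ∃ c, p.HasCost c ∧ IsLeast (costs₂ N ρ γ) c)) := by
  have nonempty₁ : ∀ ρ, IsArrivalLaw N ρ → ∀ γ : ℝ,
      ((feasiblePolicies₁ N ρ γ).Nonempty ↔ ∃ x, FlowConditions N (meanRate ρ) γ x) := by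
    intro ρ hρ γ
    constructor
    · rintro ⟨p, hp⟩
      obtain ⟨x, hx, -⟩ := Policy.Feasible₁.exists_flowConditions hρ hp
      exact ⟨x, hx⟩
    · rintro ⟨x, hx⟩
      obtain ⟨p, hp, -⟩ := hx.exists_policy₁ hρ
      exact ⟨p, hp⟩
  have nonempty₂ : ∀ ρ, IsArrivalLaw N ρ → ∀ γ : ℝ,
      ((feasiblePolicies₂ N ρ γ).Nonempty ↔ ∃ x, FlowConditions N (meanRate ρ) γ x) := by
    intro ρ hρ γ
    constructor
    · rintro ⟨p, hp⟩
      obtain ⟨x, hx, -⟩ := Policy.Feasible₂.exists_flowConditions hp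
      exact ⟨x, hx⟩
    · rintro ⟨x, hx⟩
      obtain ⟨p, hp, -⟩ := hx.exists_policy₂ hρ
      exact ⟨p, hp⟩
  have region₁ : ∀ lam γ, (lam, γ) ∈ stabilityRegion₁ N ↔
      IsRate N lam ∧ ∃ x, FlowConditions N lam γ x := by
    intro lam γ
    constructor
    · rintro ⟨ρ, hρ, rfl, hne⟩
      exact ⟨hρ.isRate, (nonempty₁ ρ hρ γ).1 hne⟩
    · rintro ⟨hlam, hx⟩
      obtain ⟨ρ, hρ, rfl⟩ := exists_isArrivalLaw hlam
      exact ⟨ρ, hρ, rfl, (nonempty₁ ρ hρ γ).2 hx⟩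
  have region₂ : ∀ lam γ, (lam, γ) ∈ stabilityRegion₂ N ↔
      IsRate N lam ∧ ∃ x, FlowConditions N lam γ x := by
    intro lam γ
    constructor
    · rintro ⟨ρ, hρ, rfl, hne⟩
      exact ⟨hρ.isRate, (nonempty₂ ρ hρ γ).1 hne⟩
    · rintro ⟨hlam, hx⟩
      obtain ⟨ρ, hρ, rfl⟩ := exists_isArrivalLaw hlam
      exact ⟨ρ, hρ, rfl, (nonempty₂ ρ hρ γ).2 hx⟩
  refine ⟨?_, fun ρ hρ γ => ⟨?_, ?_⟩, fun lam hlam γ => ⟨?_, ?_⟩, fun ρ hρ γ => ⟨?_, ?_⟩⟩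
  · ext ⟨lam, γ⟩
    rw [region₁, region₂]
  · rw [nonempty₁ ρ hρ, region₁, and_iff_right hρ.isRate]
  · rw [nonempty₂ ρ hρ, region₂, and_iff_right hρ.isRate]
  · rw [region₁, and_iff_right hlam]
  · rw [region₂, and_iff_right hlam]
  · intro h
    obtain ⟨x, hx, hmin⟩ := exists_isMinOn_flowCost ((region₁ _ _).1 h).2
    obtain ⟨p, hp, hs, hc⟩ := hx.exists_policy₁ hρ
    refine ⟨p, hp, hs, _, hc, ⟨p, hp, hc⟩, ?_⟩
    rintro c ⟨p', hp', hc'⟩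
    -- A competitor's cost is the cost of an admissible flow, hence at least the minimum of the
    -- linear program.
    obtain ⟨y, hy, hyc⟩ := Policy.Feasible₁.exists_flowConditions hρ hp'
    exact (hmin y hy).trans_eq (hyc c hc')
  · intro h
    obtain ⟨x, hx, hmin⟩ := exists_isMinOn_flowCost ((region₂ _ _).1 h).2
    obtain ⟨p, hp, hs, hc⟩ := hx.exists_policy₂ hρ
    refine ⟨p, hp, hs, _, hc, ⟨p, hp, hc⟩, ?_⟩
    rintro c ⟨p', hp', hc'⟩
    obtain ⟨y, hy, hyc⟩ := Policy.Feasible₂.exists_flowConditions hp'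
    exact (hmin y hy).trans_eq (hyc c hc')
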